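/- Let $n,d\ge 1$, $L>0$, and let $f=\frac1n\sum_{i=1}^n f_i$ with $f_i:\mathbb R^d\to\mathbb R$. Let $x^0\in\mathbb R^d$ and let $\mu,\nu>0$ be smoothing parameters. Put $$f_\mu(x)=\mathbb E_{u\sim\mathcal N(0,I_d)}[f(x+\mu u)],\qquad g_\mu(x,u,i)=\frac{f_i(x+\mu u)-f_i(x)}{\mu}\,u,\qquad g_\nu(x)=\sum_{j=1}^d\frac{f(x+\nu e_j)-f(x-\nu e_j)}{2\nu}\,e_j .$$ ZO-Varag (smooth convex case). Let $s_0=\lfloor\log_2((d+4)n)\rfloor+1$, $p_s=\frac12$, $T_s=2^{s-1}$ and $\alpha_s=\frac12$ for $s\le s_0$, $T_s=T_{s_0}$ and $\alpha_s=\frac{2}{s-s_0+4}$ for $s>s_0$, and $\gamma_s=\frac{1}{12(d+4)L\alpha_s}$; in epoch $s$ let $\theta_t=\frac{\gamma_s}{\alpha_s}(\alpha_s+p_s)$ for $1\le t\le T_s-1$ and $\theta_{T_s}=\frac{\gamma_s}{\alpha_s}$. Start with $\tilde x^0=x^0$. In epoch $s=1,2,\dots$ put $\tilde x=\tilde x^{s-1}$,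 $x_0=x^{s-1}$, $\bar x_0=\tilde x$, $\tilde g^s=g_\nu(\tilde x)$, and for $t=1,\dots,T_s$ draw $i_t$ uniformly from $\{1,\dots,n\}$ and $u_t\sim\mathcal N(0,I_d)$ (all draws independent) and set $$\underline x_t=(1-\alpha_s-p_s)\bar x_{t-1}+\alpha_s x_{t-1}+p_s\tilde x,\qquad G_t=g_\mu(\underline x_t,u_t,i_t)-g_\mu(\tilde x,u_t,i_t)+\tilde g^s,$$ $$x_t=x_{t-1}-\gamma_s G_t,\qquad \bar x_t=(1-\alpha_s-p_s)\bar x_{t-1}+\alpha_s x_t+p_s\tilde x;$$ then $x^s=x_{T_s}$ and $\tilde x^s=\sum_{t=1}^{T_s}\theta_t\bar x_t\big/\sum_{t=1}^{T_s}\theta_t$. The output after $S\ge0$ epochs is $\tilde x^S$. A function query is one evaluation of one $f_i$ at one point, so an epoch costs $2dn$ queries for $\tilde g^s$ and $4$ queries for each inner iteration. Assume: (A1) each $f_i$ is convex, differentiable and $L$-smooth, i.e. $\|\nabla f_i(x)-\nabla f_i(y)\|\le L\|x-y\|$ for all $x,y$; (A2$_\mu$) there are a finite constant $Z$ and minimizers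 $x_\mu^*\in\operatorname{argmin}f_\mu$ such that for all sufficiently small $\mu,\nu>0$ one has $\sup_{s\ge0}\mathbb E\|\tilde x^s-x_\mu^*\|\le Z$. Let $f^*=\inf f$ and $$D_0=D_0(\mu)=\frac{2}{d+4}\,[f_\mu(x^0)-f_\mu(x_\mu^*)]+6L\|x^0-x_\mu^*\|^2 .$$ Then $f^*>-\infty$, and for every $\epsilon>0$ there is $\delta>0$ such that for all $\mu,\nu\in(0,\delta)$ there is a number of epochs $S$ for which the output $\bar x=\tilde x^S$ satisfies $\mathbb E[f(\bar x)-f^*]\le\epsilon$ (with $f(\bar x)-f^*$ integrable), and the total number $\bar N_\epsilon$ of function queries made in these $S$ epochs is bounded by $$\bar N_\epsilon=\begin{cases}\mathcal O\left\{dn\log^+\frac{dD_0}{\epsilon}\right\}, & n\ge D_0/\epsilon,\\[1ex] \mathcal O\left\{dn\log(dn)+d\sqrt{\frac{nD_0}{\epsilon}}\right\}, & n<D_0/\epsilon,\end{cases}$$ where $\log^+=\max(0,\log)$ and the constants hidden in $\mathcal O$ are absolute. -/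

import Mathlib

open MeasureTheory ProbabilityTheory

namespace ZOVarag

noncomputable section

/-- `ℝ^d` with its Euclidean norm. -/
abbrev Vec (d : ℕ) : Type := EuclideanSpace ℝ (Fin d)

/-- The finite-sum objective `f = (1/n) ∑ f_i`. -/
def avg {n d : ℕ} (f : Fin n → Vec d → ℝ) (x : Vec d) : ℝ :=
  (1 / (n : ℝ)) * ∑ i, f i x

/-- Assumption (A1): each `f_i` is convex, differentiable and `L`-smooth. -/
structure SmoothConvex {n d : ℕ} (f : Fin n → Vec d → ℝ) (L : ℝ) : Prop where
  convex : ∀ i, ConvexOn ℝ Set.univ (f i)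
  differentiable : ∀ i, Differentiable ℝ (f i)
  smooth : ∀ i x y, ‖gradient (f i) x - gradient (f i) y‖ ≤ L * ‖x - y‖

/-- Gaussian smoothing `h_μ(x) = E_u[h(x + μ u)]`, `u ∼ N(0, I_d)`. -/
def smoothed {d : ℕ} (μ : ℝ) (h : Vec d → ℝ) (x : Vec d) : ℝ :=
  ∫ u, h (x + μ • u) ∂(stdGaussian (Vec d))

/-! ### The two gradient estimators and their costs in function queries -/

/-- Gaussian-smoothing estimator `((h(x + μ u) - h(x)) / μ) u`. -/
def gaussEst {d : ℕ} (h : Vec d → ℝ) (μ : ℝ) (x u : Vec d) : Vec d :=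
  ((h (x + μ • u) - h x) / μ) • u

/-- One Gaussian-smoothing estimate for one component evaluates it at `x + μ u` and at `x`. -/
def gaussCost : ℕ := 2

/-- Coordinate-wise estimator `∑_j ((h(x + ν e_j) - h(x - ν e_j)) / (2ν)) e_j`. -/
def coordEst {d : ℕ} (h : Vec d → ℝ) (ν : ℝ) (x : Vec d) : Vec d :=
  ∑ j : Fin d, ((h (x + ν • EuclideanSpace.single j (1 : ℝ))
    - h (x - ν • EuclideanSpace.single j (1 : ℝ))) / (2 * ν)) • EuclideanSpace.single j (1 : ℝ)

/-- One coordinate-wise estimate for one component evaluates it at the `2d` points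
`x ± ν e_j`. -/
def coordCost (d : ℕ) : ℕ := 2 * d

/-! ### The algorithm -/

/-- The design parameters `{T_s}`, `{γ_s}`, `{α_s}`, `{p_s}`, `{θ_t}` (the weights depend on the
epoch `s` too) and `τ`. Epochs `s` and inner iterations `t` are numbered from `1`. -/
structure Params where
  T : ℕ → ℕ
  γ : ℕ → ℝ
  α : ℕ → ℝ
  p : ℕ → ℝ
  θ : ℕ → ℕ → ℝ
  τ : ℝ

/-- State of the inner loop: `x_t`, `x̄_t` and the function queries made so far in the loop. -/
structure InnerState (d : ℕ) where
  x : Vec d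
  xbar : Vec d
  queries : ℕ

/-- State after an epoch: `x^s`, `x̃^s` and the function queries made since the start. -/
structure State (d : ℕ) where
  x : Vec d
  xtilde : Vec d
  queries : ℕ

variable {n d : ℕ}

/-- One inner iteration of epoch `s` with pivotal point `xt`, pivotal gradient `g` and sample
`ξ = (i_t, u_t)`. The new `x_t` is the minimizer of
`γ_s (⟨G_t, x⟩ + (τ/2) ‖x̲_t - x‖²) + (1/2) ‖x_{t-1} - x‖²`. -/
def innerStep (f : Fin n → Vec d → ℝ) (P : Params) (μ : ℝ) (s : ℕ) (xt g : Vec d)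
    (ξ : Fin n × Vec d) (st : InnerState d) : InnerState d :=
  let xl : Vec d := (1 + P.τ * P.γ s * (1 - P.α s))⁻¹ •
    (((1 + P.τ * P.γ s) * (1 - P.α s - P.p s)) • st.xbar + P.α s • st.x
      + ((1 + P.τ * P.γ s) * P.p s) • xt)
  let G : Vec d := gaussEst (f ξ.1) μ xl ξ.2 - gaussEst (f ξ.1) μ xt ξ.2 + g
  let x : Vec d := (1 + P.γ s * P.τ)⁻¹ • (st.x + (P.γ s * P.τ) • xl - P.γ s • G)
  { x := x
    xbar := (1 - P.α s - P.p s) • st.xbar + P.α s • x + P.p s • xt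
    queries := st.queries + (gaussCost + gaussCost) }

/-- The state of the inner loop of epoch `s` after `t` iterations. -/
def innerLoop (f : Fin n → Vec d → ℝ) (P : Params) (μ : ℝ) (s : ℕ) (x₀ xt g : Vec d)
    (ξ : ℕ → Fin n × Vec d) : ℕ → InnerState d
  | 0 => { x := x₀, xbar := xt, queries := 0 }
  | t + 1 => innerStep f P μ s xt g (ξ (t + 1)) (innerLoop f P μ s x₀ xt g ξ t)

/-- Epoch `s`: the pivotal point is `x̃^{s-1}`, the pivotal gradient is the coordinate-wise
estimate of `∇f` there (one coordinate-wise estimate for each of the `n` components). -/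
def epoch (f : Fin n → Vec d → ℝ) (P : Params) (μ ν : ℝ) (s : ℕ)
    (ξ : ℕ → Fin n × Vec d) (st : State d) : State d :=
  let it := innerLoop f P μ s st.x st.xtilde (coordEst (avg f) ν st.xtilde) ξ
  { x := (it (P.T s)).x
    xtilde := (∑ t ∈ Finset.Icc 1 (P.T s), P.θ s t)⁻¹ •
      ∑ t ∈ Finset.Icc 1 (P.T s), P.θ s t • (it t).xbar
    queries := st.queries + n * coordCost d + (it (P.T s)).queries }

/-- ZO-Varag from `x0`, run for a given number of epochs on the samples `ξ s t = (i_t, u_t)` of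
epoch `s` and inner iteration `t`. -/
def run (f : Fin n → Vec d → ℝ) (P : Params) (μ ν : ℝ) (x0 : Vec d)
    (ξ : ℕ → ℕ → Fin n × Vec d) : ℕ → State d
  | 0 => { x := x0, xtilde := x0, queries := 0 }
  | s + 1 => epoch f P μ ν (s + 1) (ξ (s + 1)) (run f P μ ν x0 ξ s)

/-- The samples are independent, and each of them is a pair of a uniform index and an independent
standard Gaussian direction. -/
structure IsSampling {Ω : Type*} [MeasurableSpace Ω] (Pr : Measure Ω)
    (ξ : ℕ → ℕ → Ω → Fin n × Vec d) : Prop where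
  measurable : ∀ s t, Measurable (ξ s t)
  law : ∀ s t, Pr.map (ξ s t) =
    (uniformOn (Set.univ : Set (Fin n))).prod (stdGaussian (Vec d))
  indep : iIndepFun (fun k : ℕ × ℕ => ξ k.1 k.2) Pr

/-! ### Parameters for smooth convex functions -/

/-- `s_0 = ⌊log₂((d+4) n)⌋ + 1`. -/
def s0 (n d : ℕ) : ℕ := Nat.log 2 ((d + 4) * n) + 1

/-- `α_s`. -/
def alpha (n d s : ℕ) : ℝ :=
  if s ≤ s0 n d then 1 / 2 else 2 / ((s : ℝ) - (s0 n d : ℝ) + 4)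

/-- `γ_s = 1 / (12 (d+4) L α_s)`. -/
def gam (n d : ℕ) (L : ℝ) (s : ℕ) : ℝ := 1 / (12 * ((d : ℝ) + 4) * L * alpha n d s)

/-- `T_s`. -/
def epochLength (n d s : ℕ) : ℕ :=
  if s ≤ s0 n d then 2 ^ (s - 1) else 2 ^ (s0 n d - 1)

/-- The parameters for smooth convex objectives (no strong convexity: `τ = 0`). -/
def convexParams (n d : ℕ) (L : ℝ) : Params where
  T := epochLength n d
  γ := gam n d L
  α := alpha n d
  p := fun _ => 1 / 2
  θ := fun s t =>
    if t < epochLength n d s then gam n d L s / alpha n d s * (alpha n d s + 1 / 2)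
    else gam n d L s / alpha n d s
  τ := 0

/-- The approximation `x̃^s` of ZO-Varag with the parameters for smooth convex objectives. -/
def approx (f : Fin n → Vec d → ℝ) (L μ ν : ℝ) (x0 : Vec d)
    (ξ : ℕ → ℕ → Fin n × Vec d) (s : ℕ) : Vec d :=
  (run f (convexParams n d L) μ ν x0 ξ s).xtilde

/-- The function queries that this run makes in its first `s` epochs. -/
def numQueries (f : Fin n → Vec d → ℝ) (L μ ν : ℝ) (x0 : Vec d)
    (ξ : ℕ → ℕ → Fin n × Vec d) (s : ℕ) : ℕ :=
  (run f (convexParams n d L) μ ν x0 ξ s).queries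

/-- Assumption (A2_μ), for the choice `xs μ` of a minimizer of `f_μ`: there is a finite `Z` with
`sup_s E‖x̃^s - x_μ^*‖ ≤ Z` for all sufficiently small smoothing parameters. -/
def BoundedInExpectation {Ω : Type*} [MeasurableSpace Ω] (Pr : Measure Ω)
    (ξ : ℕ → ℕ → Ω → Fin n × Vec d) (f : Fin n → Vec d → ℝ) (L : ℝ) (x0 : Vec d)
    (xs : ℝ → Vec d) : Prop :=
  ∃ Z δ : ℝ, 0 < δ ∧ ∀ μ ν : ℝ, 0 < μ → μ < δ → 0 < ν → ν < δ →
    IsMinOn (smoothed μ (avg f)) Set.univ (xs μ) ∧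
    ∀ s : ℕ, ∫ ω, ‖approx f L μ ν x0 (fun s t => ξ s t ω) s - xs μ‖ ∂Pr ≤ Z

/-- `D_0 = (2/(d+4)) (f_μ(x^0) - f_μ(x_μ^*)) + 6 L ‖x^0 - x_μ^*‖²`, with `xm = x_μ^*`. -/
def D0 (f : Fin n → Vec d → ℝ) (L μ : ℝ) (x0 xm : Vec d) : ℝ :=
  2 / ((d : ℝ) + 4) * (smoothed μ (avg f) x0 - smoothed μ (avg f) xm) + 6 * L * ‖x0 - xm‖ ^ 2

/-- `f^*`, the optimal value. -/
def optVal (f : Fin n → Vec d → ℝ) : ℝ := ⨅ y, avg f y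

/-- The complexity bound, up to an absolute constant, for accuracy `ε` and `D = D_0`. The positive
part of the logarithm matters only for `d D < ε`, where no query is allowed. -/
def complexity (n d : ℕ) (D ε : ℝ) : ℝ :=
  if D / ε ≤ (n : ℝ) then (d : ℝ) * n * Real.posLog (d * D / ε)
  else (d : ℝ) * n * Real.log ((d : ℝ) * n) + (d : ℝ) * Real.sqrt (n * D / ε)

end

end ZOVarag

namespace ZOVarag

noncomputable section

/-! ### Smooth convex functions -/

section SmoothCalculus

variable {E : Type*} [NormedAddCommGroup E] [InnerProductSpace ℝ E] [CompleteSpace E]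

/-! The smoothing errors are not propagated through the recursion. The run is extended to parameters
`ρ = (μ, ν) = 0`, where the estimators become `⟨∇f_i(x), u⟩ u` and the exact gradient (`dirEst`,
`pivotEst`, `runAt`). This limiting algorithm is analysed exactly, and its estimates are then
carried over to small `ρ` by dominated convergence.

In the limit, `G_t` is an unbiased estimate of `∇f(x̲_t)`. Its second moment is at most
`‖∇f(x̲_t)‖²` plus `3d` times the mean of `‖∇f_i(x̲_t) - ∇f_i(x̃)‖²`. Co-coercivity bounds that mean
by `2L` times the Bregman gap of `f` between `x̲_t` and `x̃`, and the weight `p_s = 1/2` of `x̃` in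
`x̲_t` leaves half of this gap to pay for it (`integral_stepPotential_le`). Summing over an epoch
and applying Jensen gives `expected_epoch_le`. The coefficients of consecutive epochs fit together
(`rightCoef_succ_le`), so the error after `S` epochs is of order `D_0 (d+4) / 2^S` up to `s_0`, and
`D_0 / (n (k+4)²)` after `s_0 + k` epochs.

The comparison point is `x_μ^*`. Since `f ≤ f_μ ≤ f + O(μ²)`, it minimizes `f` up to an error `η`
that vanishes with `μ`, so no minimizer of `f` itself is needed. The near-minimality costs `η` times
a constant depending on `S` (`meanValue_recursion`).

The required `S` depends on `D_0(μ)`, hence on `μ`, whereas `δ` comes first. The bound on `‖x^0 -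
x_μ^*‖` from (A2_μ) at `s = 0` bounds `D_0(μ)` uniformly, so only finitely many `S` occur and one
`δ` serves them all (`eventually_close`, `exists_epochs`). -/

lemma hasDerivAt_along_line {h : E → ℝ} {G : E → E} (hG : ∀ x, HasGradientAt h (G x) x)
    (x v : E) (t : ℝ) :
    HasDerivAt (fun t : ℝ => h (x + t • v)) (inner ℝ (G (x + t • v)) v) t := by
  have h1 : HasDerivAt (fun t : ℝ => x + t • v) v t := by
    simpa using ((hasDerivAt_id t).smul_const v).const_add x
  have h2 := (hG (x + t • v)).hasFDerivAt.comp_hasDerivAt t h1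
  simpa [Function.comp_def] using h2

/-- The descent inequality for a function with `L`-Lipschitz gradient. -/
lemma descent {h : E → ℝ} {G : E → E} {L : ℝ} (hG : ∀ x, HasGradientAt h (G x) x)
    (hL : ∀ x y, ‖G x - G y‖ ≤ L * ‖x - y‖) (x v : E) :
    h (x + v) ≤ h x + inner ℝ (G x) v + L / 2 * ‖v‖ ^ 2 := by
  -- Along the segment, `h` minus its quadratic model has nonpositive derivative.
  have hd : ∀ t : ℝ, HasDerivAt
      (fun t : ℝ => h (x + t • v) - t * inner ℝ (G x) v - L / 2 * ‖v‖ ^ 2 * t ^ 2)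
      (inner ℝ (G (x + t • v)) v - inner ℝ (G x) v - L / 2 * ‖v‖ ^ 2 * (2 * t)) t := by
    intro t
    have h1 := hasDerivAt_along_line hG x v t
    have h2 := (hasDerivAt_id t).mul_const (inner ℝ (G x) v)
    have h3 := ((hasDerivAt_id t).pow 2).const_mul (L / 2 * ‖v‖ ^ 2)
    simpa using (h1.fun_sub h2).fun_sub h3
  have hanti : AntitoneOn
      (fun t : ℝ => h (x + t • v) - t * inner ℝ (G x) v - L / 2 * ‖v‖ ^ 2 * t ^ 2)
      (Set.Icc 0 1) := by
    refine antitoneOn_of_deriv_nonpos (convex_Icc 0 1)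
      (fun t _ => (hd t).continuousAt.continuousWithinAt)
      (fun t _ => (hd t).differentiableAt.differentiableWithinAt) ?_
    intro t ht
    rw [interior_Icc] at ht
    rw [(hd t).deriv, ← inner_sub_left]
    have h1 := real_inner_le_norm (G (x + t • v) - G x) v
    have h2 := hL (x + t • v) x
    rw [add_sub_cancel_left, norm_smul, Real.norm_of_nonneg ht.1.le] at h2
    have h3 := mul_le_mul_of_nonneg_right h2 (norm_nonneg v)
    nlinarith
  have := hanti (Set.left_mem_Icc.2 zero_le_one) (Set.right_mem_Icc.2 zero_le_one) zero_le_one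
  simp at this
  linarith

lemma abs_taylor_le {h : E → ℝ} {G : E → E} {L : ℝ} (hG : ∀ x, HasGradientAt h (G x) x)
    (hL : ∀ x y, ‖G x - G y‖ ≤ L * ‖x - y‖) (x v : E) :
    |h (x + v) - h x - inner ℝ (G x) v| ≤ L / 2 * ‖v‖ ^ 2 := by
  rw [abs_le]
  have h1 := descent hG hL x v
  have h2 := descent (h := fun x => - h x) (G := fun x => - G x) (L := L)
    (fun x => by
      have := (hG x).hasFDerivAt.fun_neg
      rw [hasGradientAt_iff_hasFDerivAt]
      simpa using this)
    (fun x y => by rw [← neg_sub', norm_neg]; exact hL x y) x v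
  rw [inner_neg_left] at h2
  constructor <;> linarith

lemma convex_gradient_le {h : E → ℝ} {G : E → E} (hG : ∀ x, HasGradientAt h (G x) x)
    (hc : ConvexOn ℝ Set.univ h) (x y : E) : h x + inner ℝ (G x) (y - x) ≤ h y := by
  have hc' : ConvexOn ℝ Set.univ (fun t : ℝ => h (x + t • (y - x))) := by
    have h1 := hc.comp_affineMap (AffineMap.lineMap x y : ℝ →ᵃ[ℝ] E)
    have h2 : (fun t : ℝ => h (x + t • (y - x))) = h ∘ (AffineMap.lineMap x y : ℝ →ᵃ[ℝ] E) := by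
      funext t
      simp [AffineMap.lineMap_apply, add_comm]
    rw [h2]
    exact h1
  have := hc'.le_slope_of_hasDerivAt (Set.mem_univ 0) (Set.mem_univ 1) zero_lt_one
    (by simpa using hasDerivAt_along_line hG x (y - x) 0)
  simp [slope_def_field] at this
  linarith

/-- The gradient of a smooth function at a point which is minimal up to `η`. -/
lemma norm_gradient_sq_le {h : E → ℝ} {G : E → E} {L η : ℝ} (hLpos : 0 < L)
    (hG : ∀ x, HasGradientAt h (G x) x) (hL : ∀ x y, ‖G x - G y‖ ≤ L * ‖x - y‖) (z : E)
    (hz : ∀ y, h z ≤ h y + η) : ‖G z‖ ^ 2 ≤ 2 * L * η := by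
  -- A gradient step of length `1/L` gains at least `‖G z‖² / (2L)`, and no step from `z` gains more
  -- than `η`.
  have h1 := descent hG hL z (-(L⁻¹ • G z))
  have h2 := hz (z + -(L⁻¹ • G z))
  rw [inner_neg_right, real_inner_smul_right, real_inner_self_eq_norm_sq, norm_neg, norm_smul,
    Real.norm_of_nonneg (inv_nonneg.2 hLpos.le)] at h1
  have h3 : L⁻¹ * ‖G z‖ ^ 2 ≤ 2 * η := by
    have : L / 2 * (L⁻¹ * ‖G z‖) ^ 2 = L⁻¹ * ‖G z‖ ^ 2 / 2 := by field_simp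
    linarith
  rw [inv_mul_le_iff₀ hLpos] at h3
  linarith

/-- A convex function with `L`-Lipschitz gradient has a co-coercive gradient. -/
lemma cocoercive {h : E → ℝ} {G : E → E} {L : ℝ} (hLpos : 0 < L)
    (hG : ∀ x, HasGradientAt h (G x) x) (hL : ∀ x y, ‖G x - G y‖ ≤ L * ‖x - y‖)
    (hc : ConvexOn ℝ Set.univ h) (x y : E) :
    ‖G y - G x‖ ^ 2 ≤ 2 * L * (h y - h x - inner ℝ (G x) (y - x)) := by
  -- After subtracting this linear function, convexity makes `x` a global minimizer, so `y` is
  -- minimal up to its Bregman gap.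
  refine norm_gradient_sq_le (h := fun w => h w - inner ℝ (G x) w) (G := fun w => G w - G x)
    (η := h y - h x - inner ℝ (G x) (y - x)) hLpos (fun w => ?_) (fun a b => ?_) y (fun w => ?_)
  · rw [hasGradientAt_iff_hasFDerivAt, map_sub]
    exact (hG w).hasFDerivAt.sub (innerSL ℝ (G x)).hasFDerivAt
  · rw [sub_sub_sub_cancel_right]; exact hL a b
  · have := convex_gradient_le hG hc x w
    rw [inner_sub_right] at *
    linarith

end SmoothCalculus

/-! ### The average objective and its gradient -/

section Components

variable {n d : ℕ} {f : Fin n → Vec d → ℝ} {L : ℝ}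

/-- The gradient of the average. -/
def avgGrad (f : Fin n → Vec d → ℝ) (x : Vec d) : Vec d :=
  (1 / (n : ℝ)) • ∑ i, gradient (f i) x

lemma SmoothConvex.hasGradientAt (hf : SmoothConvex f L) (i : Fin n) (x : Vec d) :
    HasGradientAt (f i) (gradient (f i) x) x :=
  (hf.differentiable i x).hasGradientAt

lemma SmoothConvex.hasGradientAt_avg (hf : SmoothConvex f L) (x : Vec d) :
    HasGradientAt (avg f) (avgGrad f x) x := by
  rw [hasGradientAt_iff_hasFDerivAt]
  have h := (HasFDerivAt.fun_sum (u := Finset.univ)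
    (fun i _ => (hf.hasGradientAt i x).hasFDerivAt)).const_mul (1 / (n : ℝ))
  have e : avg f = fun y => 1 / (n : ℝ) * ∑ i, f i y := rfl
  rw [e]
  simpa [avgGrad] using h

lemma SmoothConvex.avgGrad_lipschitz (hn : 1 ≤ n) (hf : SmoothConvex f L) (x y : Vec d) :
    ‖avgGrad f x - avgGrad f y‖ ≤ L * ‖x - y‖ := by
  have hn' : (0 : ℝ) < n := by exact_mod_cast hn
  rw [avgGrad, avgGrad, ← smul_sub, ← Finset.sum_sub_distrib, norm_smul,
    Real.norm_of_nonneg (by positivity)]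
  have : ‖∑ i, (gradient (f i) x - gradient (f i) y)‖ ≤ n * (L * ‖x - y‖) := by
    refine (norm_sum_le_of_le _ (fun i _ => hf.smooth i x y)).trans ?_
    simp
  calc 1 / (n : ℝ) * _ ≤ 1 / (n : ℝ) * (n * (L * ‖x - y‖)) := by gcongr
    _ = L * ‖x - y‖ := by field_simp

lemma SmoothConvex.convexOn_avg (hf : SmoothConvex f L) : ConvexOn ℝ Set.univ (avg f) := by
  have h : ConvexOn ℝ Set.univ (fun x => ∑ i, f i x) := by
    have : ∀ s : Finset (Fin n), ConvexOn ℝ Set.univ (fun x => ∑ i ∈ s, f i x) := by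
      intro s
      induction s using Finset.cons_induction with
      | empty => simpa using convexOn_const (0 : ℝ) convex_univ
      | cons i s hi ih =>
        simp only [Finset.sum_cons]
        exact (hf.convex i).add ih
    exact this _
  exact h.smul (c := 1 / (n : ℝ)) (by positivity)

lemma avg_cocoercive (hL : 0 < L) (hf : SmoothConvex f L) (x y : Vec d) :
    1 / (n : ℝ) * ∑ i, ‖gradient (f i) x - gradient (f i) y‖ ^ 2
      ≤ 2 * L * (avg f y - avg f x - inner ℝ (avgGrad f x) (y - x)) := by
  have h : ∀ i, ‖gradient (f i) x - gradient (f i) y‖ ^ 2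
      ≤ 2 * L * (f i y - f i x - inner ℝ (gradient (f i) x) (y - x)) := by
    intro i
    rw [norm_sub_rev]
    exact cocoercive hL (hf.hasGradientAt i) (hf.smooth i) (hf.convex i) x y
  calc _ ≤ 1 / (n : ℝ) *
        ∑ i, 2 * L * (f i y - f i x - inner ℝ (gradient (f i) x) (y - x)) := by
        gcongr with i; exact h i
    _ = _ := by
        rw [← Finset.mul_sum, Finset.sum_sub_distrib, Finset.sum_sub_distrib, avg, avg, avgGrad,
          real_inner_smul_left, sum_inner]
        ring

/-! ### The estimators, extended to vanishing smoothing parameters -/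

/-- The Gaussian-smoothing estimator, and its limit `⟨∇h(x), u⟩ u` for `μ = 0`. -/
def dirEst (h : Vec d → ℝ) (μ : ℝ) (x u : Vec d) : Vec d :=
  if μ = 0 then (inner ℝ (gradient h x) u) • u else gaussEst h μ x u

/-- The coordinate-wise estimator of the gradient of `avg f`, and its limit for `ν = 0`. -/
def pivotEst (f : Fin n → Vec d → ℝ) (ν : ℝ) (x : Vec d) : Vec d :=
  if ν = 0 then avgGrad f x else coordEst (avg f) ν x

lemma norm_dirEst_sub_le (hf : SmoothConvex f L) (i : Fin n) (μ : ℝ) (x u : Vec d) :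
    ‖dirEst (f i) μ x u - dirEst (f i) 0 x u‖ ≤ L / 2 * |μ| * ‖u‖ ^ 3 := by
  rcases eq_or_ne μ 0 with rfl | hμ
  · simp
  · have h := abs_taylor_le (hf.hasGradientAt i) (hf.smooth i) x (μ • u)
    rw [dirEst, dirEst, if_neg hμ, if_pos rfl, gaussEst, ← sub_smul, norm_smul, Real.norm_eq_abs]
    have h1 : (f i (x + μ • u) - f i x) / μ - inner ℝ (gradient (f i) x) u
        = (f i (x + μ • u) - f i x - inner ℝ (gradient (f i) x) (μ • u)) / μ := by
      rw [real_inner_smul_right]; field_simp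
    rw [h1, abs_div]
    have hμ' : 0 < |μ| := abs_pos.2 hμ
    calc _ ≤ (L / 2 * ‖μ • u‖ ^ 2) / |μ| * ‖u‖ := by gcongr
      _ = _ := by rw [norm_smul, Real.norm_eq_abs]; field_simp

lemma norm_pivotEst_sub_le (hn : 1 ≤ n) (hf : SmoothConvex f L) (ν : ℝ) (x : Vec d) :
    ‖pivotEst f ν x - pivotEst f 0 x‖ ≤ d * (L / 2 * |ν|) := by
  rcases eq_or_ne ν 0 with rfl | hν
  · simp
  · have hx : pivotEst f 0 x = ∑ j : Fin d,
        (inner ℝ (avgGrad f x) (EuclideanSpace.single j (1 : ℝ))) •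
          EuclideanSpace.single j (1 : ℝ) := by
      rw [pivotEst, if_pos rfl]
      ext k
      simp [EuclideanSpace.inner_single_right, Pi.single_apply]
    rw [hx, pivotEst, if_neg hν, coordEst, ← Finset.sum_sub_distrib]
    have hν' : 0 < |ν| := abs_pos.2 hν
    have key : ∀ j ∈ (Finset.univ : Finset (Fin d)),
        ‖((avg f (x + ν • EuclideanSpace.single j (1 : ℝ))
          - avg f (x - ν • EuclideanSpace.single j (1 : ℝ))) / (2 * ν)) •
            (EuclideanSpace.single j (1 : ℝ) : Vec d)
          - (inner ℝ (avgGrad f x) (EuclideanSpace.single j (1 : ℝ))) •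
            EuclideanSpace.single j (1 : ℝ)‖ ≤ L / 2 * |ν| := by
      intro j _
      set e : Vec d := EuclideanSpace.single j (1 : ℝ) with he
      have hen : ‖e‖ = 1 := by simp [he]
      have h1 := abs_taylor_le hf.hasGradientAt_avg (hf.avgGrad_lipschitz hn) x (ν • e)
      have h2 := abs_taylor_le hf.hasGradientAt_avg (hf.avgGrad_lipschitz hn) x (-(ν • e))
      rw [← sub_smul, norm_smul, Real.norm_eq_abs, hen, mul_one]
      -- The error of the central difference is a difference of two Taylor remainders, each at most
      -- `L ν² / 2`.
      have h3 : (avg f (x + ν • e) - avg f (x - ν • e)) / (2 * ν) - inner ℝ (avgGrad f x) e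
          = ((avg f (x + ν • e) - avg f x - inner ℝ (avgGrad f x) (ν • e))
            - (avg f (x + -(ν • e)) - avg f x - inner ℝ (avgGrad f x) (-(ν • e)))) / (2 * ν) := by
        rw [inner_neg_right, real_inner_smul_right, ← sub_eq_add_neg]; field_simp; ring
      rw [norm_neg] at h2
      rw [norm_smul, hen, mul_one, Real.norm_eq_abs] at h1 h2
      rw [h3, abs_div, abs_mul, abs_two, div_le_iff₀ (by positivity)]
      refine (abs_sub _ _).trans ?_
      linarith
    refine (norm_sum_le_of_le _ key).trans ?_
    simp

end Components

/-! ### Moments of the standard Gaussian and of the samples -/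

section Moments

lemma integrable_pow_mul_exp_neg_sq (k : ℕ) :
    Integrable (fun x : ℝ => x ^ k * Real.exp (-(1 / 2) * x ^ 2)) := by
  have h := integrable_rpow_mul_exp_neg_mul_sq (b := 1 / 2) (by norm_num) (s := (k : ℝ))
    (by have : (0 : ℝ) ≤ k := k.cast_nonneg
        linarith)
  simpa [Real.rpow_natCast] using h

/-- Integration by parts: the derivative of `x^(k+1) exp(-x²/2)` has integral zero. -/
lemma integral_pow_add_two_mul_exp (k : ℕ) :
    ∫ x : ℝ, x ^ (k + 2) * Real.exp (-(1 / 2) * x ^ 2)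
      = (k + 1) * ∫ x : ℝ, x ^ k * Real.exp (-(1 / 2) * x ^ 2) := by
  have hd : ∀ x : ℝ, HasDerivAt (fun x : ℝ => x ^ (k + 1) * Real.exp (-(1 / 2) * x ^ 2))
      ((k + 1) * (x ^ k * Real.exp (-(1 / 2) * x ^ 2))
        - x ^ (k + 2) * Real.exp (-(1 / 2) * x ^ 2)) x := by
    intro x
    have h1 : HasDerivAt (fun x : ℝ => x ^ (k + 1)) ((k + 1) * x ^ k) x := by
      simpa using hasDerivAt_pow (k + 1) x
    have h2 : HasDerivAt (fun x : ℝ => -(1 / 2) * x ^ 2) (-x) x := by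
      convert! (hasDerivAt_pow 2 x).const_mul (-(1 / 2 : ℝ)) using 1
      simp
    convert! h1.mul h2.exp using 1
    ring
  have h := integral_eq_zero_of_hasDerivAt_of_integrable hd
    (((integrable_pow_mul_exp_neg_sq k).const_mul _).sub (integrable_pow_mul_exp_neg_sq (k + 2)))
    (integrable_pow_mul_exp_neg_sq (k + 1))
  rw [integral_sub ((integrable_pow_mul_exp_neg_sq k).const_mul _)
    (integrable_pow_mul_exp_neg_sq (k + 2)), integral_const_mul] at h
  linarith

lemma integral_gaussianReal_pow (k : ℕ) : ∫ x, x ^ k ∂(gaussianReal 0 1)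
    = (√(2 * Real.pi))⁻¹ * ∫ x : ℝ, x ^ k * Real.exp (-(1 / 2) * x ^ 2) := by
  rw [integral_gaussianReal_eq_integral_smul one_ne_zero, ← integral_const_mul]
  congr 1
  funext x
  simp only [gaussianPDFReal, smul_eq_mul, NNReal.coe_one, mul_one, sub_zero]
  rw [show -x ^ 2 / 2 = -(1 / 2) * x ^ 2 by ring]
  ring

lemma integral_gaussianReal_pow_four : ∫ x, x ^ 4 ∂(gaussianReal 0 1) = 3 := by
  have h0 := integral_gaussianReal_pow 0
  rw [integral_gaussianReal_pow, integral_pow_add_two_mul_exp 2, integral_pow_add_two_mul_exp 0]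
  simp only [pow_zero, integral_const, probReal_univ, smul_eq_mul, mul_one, one_mul] at h0 ⊢
  push_cast
  linarith

variable {d : ℕ}

lemma integrable_norm_pow_stdGaussian (k : ℕ) :
    Integrable (fun u : Vec d => ‖u‖ ^ k) (stdGaussian (Vec d)) := by
  have h := (IsGaussian.memLp_id (stdGaussian (Vec d)) k (by simp)).integrable_norm_pow'
  simpa using h

lemma integral_inner_stdGaussian (a : Vec d) :
    ∫ u, inner ℝ a u ∂(stdGaussian (Vec d)) = 0 := by
  simpa using integral_strongDual_stdGaussian (innerSL ℝ a)

lemma integrable_of_norm_le_pow {F : Type*} [NormedAddCommGroup F] {φ : Vec d → F}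
    (hφ : AEStronglyMeasurable φ (stdGaussian (Vec d))) (C : ℝ) (k : ℕ)
    (h : ∀ u, ‖φ u‖ ≤ C * ‖u‖ ^ k) : Integrable φ (stdGaussian (Vec d)) :=
  ((integrable_norm_pow_stdGaussian k).const_mul C).mono' hφ (Filter.Eventually.of_forall h)

lemma norm_inner_smul_self_le (a u : Vec d) : ‖(inner ℝ a u : ℝ) • u‖ ≤ ‖a‖ * ‖u‖ ^ 2 := by
  rw [norm_smul, pow_two, ← mul_assoc]
  gcongr
  exact norm_inner_le_norm a u

lemma integrable_inner_smul_stdGaussian (a : Vec d) :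
    Integrable (fun u : Vec d => (inner ℝ a u : ℝ) • u) (stdGaussian (Vec d)) :=
  integrable_of_norm_le_pow (by fun_prop) ‖a‖ 2 (norm_inner_smul_self_le a)

lemma integrable_norm_sq_inner_smul_stdGaussian (a : Vec d) :
    Integrable (fun u : Vec d => ‖(inner ℝ a u : ℝ) • u‖ ^ 2) (stdGaussian (Vec d)) := by
  refine integrable_of_norm_le_pow (by fun_prop) (‖a‖ ^ 2) 4 (fun u => ?_)
  rw [norm_pow, norm_norm]
  calc _ ≤ (‖a‖ * ‖u‖ ^ 2) ^ 2 := by gcongr; exact norm_inner_smul_self_le a u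
    _ = _ := by ring

lemma integral_inner_mul_inner_stdGaussian (a b : Vec d) :
    ∫ u, inner ℝ a u * inner ℝ b u ∂(stdGaussian (Vec d)) = inner ℝ a b := by
  have h := covarianceBilin_apply_eq_cov (μ := stdGaussian (Vec d)) IsGaussian.memLp_two_id a b
  rw [covarianceBilin_stdGaussian, innerSL_apply_apply, covariance_eq_sub] at h
  · simpa [integral_inner_stdGaussian] using h.symm
  · exact (IsGaussian.memLp_two_id (μ := stdGaussian (Vec d))).const_inner a
  · exact (IsGaussian.memLp_two_id (μ := stdGaussian (Vec d))).const_inner b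

lemma integral_inner_smul_stdGaussian (a : Vec d) :
    ∫ u, (inner ℝ a u : ℝ) • u ∂(stdGaussian (Vec d)) = a := by
  refine ext_inner_left ℝ fun b => ?_
  rw [← integral_inner (integrable_inner_smul_stdGaussian a)]
  simp_rw [real_inner_smul_right, integral_inner_mul_inner_stdGaussian]
  exact real_inner_comm _ _

lemma integral_inner_pow_four_stdGaussian {a : Vec d} (ha : ‖a‖ = 1) :
    ∫ u, (inner ℝ a u) ^ 4 ∂(stdGaussian (Vec d)) = 3 := by
  have h := IsGaussian.map_eq_gaussianReal (μ := stdGaussian (Vec d)) (innerSL ℝ a)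
  rw [integral_strongDual_stdGaussian, variance_dual_stdGaussian, innerSL_apply_norm, ha] at h
  simp only [one_pow, Real.toNNReal_one] at h
  rw [← integral_gaussianReal_pow_four, ← h, integral_map (by fun_prop) (by fun_prop)]
  simp

/-- For unit `a`, write `⟨a,u⟩²‖u‖²` as a sum of `⟨a,u⟩² u_j²` and use `2st ≤ s² + t²`, so that only
fourth moments of one-dimensional Gaussians occur. The sharp constant is `d + 2`; the step sizes
leave room for `3d`. -/
lemma integral_norm_sq_inner_smul_stdGaussian_le (a : Vec d) :
    ∫ u, ‖(inner ℝ a u : ℝ) • u‖ ^ 2 ∂(stdGaussian (Vec d)) ≤ 3 * d * ‖a‖ ^ 2 := by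
  have hint : ∀ b : Vec d, Integrable (fun u : Vec d => (inner ℝ b u) ^ 4)
      (stdGaussian (Vec d)) := by
    intro b
    refine integrable_of_norm_le_pow (by fun_prop) (‖b‖ ^ 4) 4 (fun u => ?_)
    rw [norm_pow, ← mul_pow]
    gcongr
    exact norm_inner_le_norm b u
  have unit : ∀ b : Vec d, ‖b‖ = 1 →
      ∫ u, ‖(inner ℝ b u : ℝ) • u‖ ^ 2 ∂(stdGaussian (Vec d)) ≤ 3 * d := by
    intro b hb
    have hle : ∀ u : Vec d, ‖(inner ℝ b u : ℝ) • u‖ ^ 2 ≤ ∑ j : Fin d,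
        (1 / 2 * (inner ℝ b u) ^ 4
          + 1 / 2 * (inner ℝ (EuclideanSpace.single j (1 : ℝ)) u) ^ 4) := by
      intro u
      rw [norm_smul, mul_pow, EuclideanSpace.real_norm_sq_eq u, Finset.mul_sum, Real.norm_eq_abs,
        sq_abs]
      refine Finset.sum_le_sum fun j _ => ?_
      have : inner ℝ (EuclideanSpace.single j (1 : ℝ)) u = u j := by
        simp [EuclideanSpace.inner_single_left]
      rw [this]
      nlinarith [sq_nonneg ((inner ℝ b u) ^ 2 - (u j) ^ 2)]
    calc _ ≤ ∫ u, ∑ j : Fin d, (1 / 2 * (inner ℝ b u) ^ 4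
          + 1 / 2 * (inner ℝ (EuclideanSpace.single j (1 : ℝ)) u) ^ 4)
            ∂(stdGaussian (Vec d)) :=
          integral_mono (integrable_norm_sq_inner_smul_stdGaussian b)
            (integrable_finsetSum _ fun j _ =>
              ((hint b).const_mul _).add ((hint _).const_mul _)) hle
      _ = 3 * d := by
          rw [integral_finsetSum _ fun j _ => by
            exact ((hint b).const_mul _).add ((hint _).const_mul _)]
          have : ∀ j : Fin d, ∫ u, (1 / 2 * (inner ℝ b u) ^ 4
              + 1 / 2 * (inner ℝ (EuclideanSpace.single j (1 : ℝ)) u) ^ 4)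
                ∂(stdGaussian (Vec d)) = 3 := by
            intro j
            rw [integral_add ((hint b).const_mul _) ((hint _).const_mul _), integral_const_mul,
              integral_const_mul, integral_inner_pow_four_stdGaussian hb,
              integral_inner_pow_four_stdGaussian (by simp)]
            norm_num
          rw [Finset.sum_congr rfl fun j _ => this j]
          simp [mul_comm]
  rcases eq_or_ne a 0 with rfl | ha
  · simp
  · have ha' : ‖a‖ ≠ 0 := norm_ne_zero_iff.2 ha
    have h := unit (‖a‖⁻¹ • a) (by rw [norm_smul, norm_inv, norm_norm, inv_mul_cancel₀ ha'])
    have e : ∀ u : Vec d, ‖(inner ℝ a u : ℝ) • u‖ ^ 2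
        = ‖a‖ ^ 2 * ‖(inner ℝ (‖a‖⁻¹ • a) u : ℝ) • u‖ ^ 2 := by
      intro u
      rw [real_inner_smul_left, mul_smul, norm_smul ‖a‖⁻¹, norm_inv, norm_norm]
      field_simp
    simp_rw [e, integral_const_mul]
    rw [mul_comm (3 * (d : ℝ))]
    gcongr

/-- The law of one sample. -/
def sampleLaw (n d : ℕ) : Measure (Fin n × Vec d) :=
  (uniformOn (Set.univ : Set (Fin n))).prod (stdGaussian (Vec d))

variable {n : ℕ}

lemma isProbabilityMeasure_sampleLaw (hn : 1 ≤ n) : IsProbabilityMeasure (sampleLaw n d) := by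
  have : Nonempty (Fin n) := ⟨⟨0, hn⟩⟩
  have : IsProbabilityMeasure (uniformOn (Set.univ : Set (Fin n))) :=
    isProbabilityMeasure_uniformOn Set.finite_univ Set.univ_nonempty
  unfold sampleLaw
  infer_instance

lemma integrable_sampleLaw {F : Type*} [NormedAddCommGroup F] [MeasurableSpace F]
    [BorelSpace F] [SecondCountableTopology F] (hn : 1 ≤ n)
    {φ : Fin n → Vec d → F} (h : ∀ i, Integrable (φ i) (stdGaussian (Vec d)))
    (hm : ∀ i, Measurable (φ i)) :
    Integrable (fun ξ : Fin n × Vec d => φ ξ.1 ξ.2) (sampleLaw n d) := by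
  have : Nonempty (Fin n) := ⟨⟨0, hn⟩⟩
  have : IsProbabilityMeasure (uniformOn (Set.univ : Set (Fin n))) :=
    isProbabilityMeasure_uniformOn Set.finite_univ Set.univ_nonempty
  have hs : StronglyMeasurable (fun ξ : Fin n × Vec d => φ ξ.1 ξ.2) := by
    exact (measurable_from_prod_countable_right fun i => hm i).stronglyMeasurable
  rw [sampleLaw, integrable_prod_iff hs.aestronglyMeasurable]
  exact ⟨Filter.Eventually.of_forall h, Integrable.of_finite⟩

lemma integral_sampleLaw {F : Type*} [NormedAddCommGroup F] [NormedSpace ℝ F] [CompleteSpace F]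
    [MeasurableSpace F] [BorelSpace F] [SecondCountableTopology F] (hn : 1 ≤ n)
    {φ : Fin n → Vec d → F} (h : ∀ i, Integrable (φ i) (stdGaussian (Vec d)))
    (hm : ∀ i, Measurable (φ i)) :
    ∫ ξ, φ ξ.1 ξ.2 ∂(sampleLaw n d) = (1 / (n : ℝ)) • ∑ i, ∫ u, φ i u ∂(stdGaussian (Vec d)) := by
  have hne : Nonempty (Fin n) := ⟨⟨0, hn⟩⟩
  have hp : IsProbabilityMeasure (uniformOn (Set.univ : Set (Fin n))) :=
    isProbabilityMeasure_uniformOn Set.finite_univ Set.univ_nonempty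
  have hi := integrable_sampleLaw hn h hm
  rw [sampleLaw] at hi ⊢
  rw [integral_prod _ hi, integral_fintype Integrable.of_finite, Finset.smul_sum]
  refine Finset.sum_congr rfl fun i _ => ?_
  congr 1
  rw [measureReal_def, uniformOn_univ]
  simp

end Moments

/-! ### Families of random vectors indexed by the smoothing parameters -/

section Estimators

variable {n d : ℕ} {f : Fin n → Vec d → ℝ} {L : ℝ}

lemma continuous_gradient (hf : SmoothConvex f L) (i : Fin n) : Continuous (gradient (f i)) :=
  (LipschitzWith.of_dist_le_mul (K := L.toNNReal) fun x y => by
    rw [dist_eq_norm, dist_eq_norm]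
    refine (hf.smooth i x y).trans ?_
    gcongr
    exact Real.le_coe_toNNReal L).continuous

lemma continuous_avgGrad (hf : SmoothConvex f L) : Continuous (avgGrad f) := by
  have := fun i => continuous_gradient hf i
  unfold avgGrad
  fun_prop

lemma continuous_component (hf : SmoothConvex f L) (i : Fin n) : Continuous (f i) :=
  (hf.differentiable i).continuous

lemma continuous_avg (hf : SmoothConvex f L) : Continuous (avg f) := by
  have := fun i => continuous_component hf i
  unfold avg
  fun_prop

lemma measurable_dirEst (hf : SmoothConvex f L) (μ : ℝ) :
    Measurable (fun q : Vec d × (Fin n × Vec d) => dirEst (f q.2.1) μ q.1 q.2.2) := by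
  have h : Measurable (fun q : Fin n × (Vec d × Vec d) => dirEst (f q.1) μ q.2.1 q.2.2) := by
    refine measurable_from_prod_countable_right fun i => Continuous.measurable ?_
    have h1 := continuous_gradient hf i
    have h2 := continuous_component hf i
    by_cases hμ : μ = 0
    · simp only [dirEst, if_pos hμ]
      fun_prop
    · simp only [dirEst, if_neg hμ, gaussEst]
      fun_prop
  exact h.comp (f := fun q : Vec d × (Fin n × Vec d) => (q.2.1, q.1, q.2.2)) (by fun_prop)

lemma measurable_dirEst_comp {Ω : Type*} {m : MeasurableSpace Ω} (hf : SmoothConvex f L) (μ : ℝ)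
    {X : Ω → Vec d} {ζ : Ω → Fin n × Vec d} (hX : Measurable X) (hζ : Measurable ζ) :
    Measurable (fun ω => dirEst (f (ζ ω).1) μ (X ω) (ζ ω).2) := by
  have h := (measurable_dirEst hf μ).comp (hX.prodMk hζ)
  exact h

lemma measurable_one_add_norm_snd {Ω : Type*} {m : MeasurableSpace Ω} {ζ : Ω → Fin n × Vec d}
    (hζ : Measurable ζ) : Measurable (fun ω => 1 + ‖(ζ ω).2‖) := by
  fun_prop

lemma measurable_pivotEst (hf : SmoothConvex f L) (ν : ℝ) : Measurable (pivotEst f ν) := by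
  have h1 := continuous_avgGrad hf
  have h2 := continuous_avg hf
  unfold pivotEst coordEst
  refine Continuous.measurable ?_
  by_cases hν : ν = 0
  · simpa only [if_pos hν] using h1
  · simp only [if_neg hν]
    fun_prop

lemma norm_dirEst_zero_sub_le (hf : SmoothConvex f L) (i : Fin n) (x y u : Vec d) :
    ‖dirEst (f i) 0 x u - dirEst (f i) 0 y u‖ ≤ L * ‖x - y‖ * ‖u‖ ^ 2 := by
  simp only [dirEst, if_pos]
  rw [← sub_smul, ← inner_sub_left]
  refine (norm_inner_smul_self_le _ u).trans ?_
  gcongr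
  exact hf.smooth i x y

/-- The bound is a product of a function of `x` and a function of `u`, so that independence of the
new direction from the past can be used. -/
lemma norm_dirEst_le (hL : 0 < L) (hf : SmoothConvex f L) (i : Fin n) {μ : ℝ} (hμ : |μ| ≤ 1)
    (x u : Vec d) :
    ‖dirEst (f i) μ x u‖ ≤ (∑ j, ‖gradient (f j) 0‖ + L + L * ‖x‖) * (1 + ‖u‖) ^ 3 := by
  have h1 := norm_dirEst_sub_le hf i μ x u
  have h2 := norm_dirEst_zero_sub_le hf i x 0 u
  have h3 : ‖dirEst (f i) 0 0 u‖ ≤ (∑ j, ‖gradient (f j) 0‖) * ‖u‖ ^ 2 := by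
    simp only [dirEst, if_pos]
    refine (norm_inner_smul_self_le _ u).trans ?_
    gcongr
    exact Finset.single_le_sum (f := fun j => ‖gradient (f j) 0‖)
      (fun j _ => norm_nonneg _) (Finset.mem_univ i)
  rw [sub_zero] at h2
  have hS : 0 ≤ ∑ j, ‖gradient (f j) 0‖ := Finset.sum_nonneg fun j _ => norm_nonneg _
  have hu := norm_nonneg u
  have h4 : L / 2 * |μ| * ‖u‖ ^ 3 ≤ L * ‖u‖ ^ 3 := by
    have : L / 2 * |μ| ≤ L := by nlinarith
    gcongr
  have h5 : ‖dirEst (f i) μ x u‖ ≤ ‖dirEst (f i) μ x u - dirEst (f i) 0 x u‖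
      + ‖dirEst (f i) 0 x u - dirEst (f i) 0 0 u‖ + ‖dirEst (f i) 0 0 u‖ := by
    have e : dirEst (f i) μ x u = (dirEst (f i) μ x u - dirEst (f i) 0 x u)
      + (dirEst (f i) 0 x u - dirEst (f i) 0 0 u) + dirEst (f i) 0 0 u := by abel
    conv_lhs => rw [e]
    exact norm_add₃_le
  have h6 : ‖u‖ ^ 2 ≤ (1 + ‖u‖) ^ 3 := by nlinarith [pow_nonneg hu 3]
  have h7 : ‖u‖ ^ 3 ≤ (1 + ‖u‖) ^ 3 := by gcongr; linarith
  calc _ ≤ L * ‖u‖ ^ 3 + L * ‖x‖ * ‖u‖ ^ 2 + (∑ j, ‖gradient (f j) 0‖) * ‖u‖ ^ 2 := by linarith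
    _ ≤ L * (1 + ‖u‖) ^ 3 + L * ‖x‖ * (1 + ‖u‖) ^ 3
        + (∑ j, ‖gradient (f j) 0‖) * (1 + ‖u‖) ^ 3 :=
      add_le_add (add_le_add (mul_le_mul_of_nonneg_left h7 hL.le)
        (mul_le_mul_of_nonneg_left h6 (by positivity))) (mul_le_mul_of_nonneg_left h6 hS)
    _ = _ := by ring

lemma norm_pivotEst_le (hn : 1 ≤ n) (hL : 0 < L) (hf : SmoothConvex f L) {ν : ℝ} (hν : |ν| ≤ 1)
    (x : Vec d) : ‖pivotEst f ν x‖ ≤ d * L + ‖avgGrad f 0‖ + L * ‖x‖ := by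
  have h1 := norm_pivotEst_sub_le hn hf ν x
  have h2 := hf.avgGrad_lipschitz hn x 0
  rw [sub_zero] at h2
  have h3 : pivotEst f 0 x = avgGrad f x := by simp [pivotEst]
  have h4 := norm_le_norm_add_norm_sub' (pivotEst f ν x) (pivotEst f 0 x)
  have h5 := norm_le_norm_add_norm_sub' (avgGrad f x) (avgGrad f 0)
  have h6 : (d : ℝ) * (L / 2 * |ν|) ≤ d * L := by
    gcongr
    nlinarith
  rw [h3] at h4 h1
  linarith

end Estimators

/-! ### Domination and continuity in the smoothing parameters -/

section Tame

variable {n d : ℕ} {f : Fin n → Vec d → ℝ} {L : ℝ} {Ω : Type*} {m m' : MeasurableSpace Ω}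
  [m0 : MeasurableSpace Ω] {Pr : Measure Ω}

/-- A family of `m`-measurable random vectors, indexed by the smoothing parameters, which is
dominated in `L²` for small parameters and depends continuously on them at `0`. -/
structure Tame (m : MeasurableSpace Ω) [m0 : MeasurableSpace Ω] (Pr : Measure Ω)
    (X : ℝ × ℝ → Ω → Vec d) : Prop where
  measurable : ∀ ρ, Measurable[m] (X ρ)
  dominated : ∃ W : Ω → ℝ, Measurable[m] W ∧ MemLp W 2 Pr ∧
    ∀ ρ, ‖ρ‖ ≤ 1 → ∀ ω, ‖X ρ ω‖ ≤ W ω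
  continuousAt : ∀ ω, ContinuousAt (fun ρ => X ρ ω) 0

/-- A sample which is independent of the past `m`. -/
structure Fresh (m : MeasurableSpace Ω) [m0 : MeasurableSpace Ω] (Pr : Measure Ω)
    (ζ : Ω → Fin n × Vec d) : Prop where
  le : m ≤ m0
  measurable : Measurable ζ
  law : Pr.map ζ = sampleLaw n d
  indep : Indep m (MeasurableSpace.comap ζ inferInstance) Pr

lemma Tame.mono {X : ℝ × ℝ → Ω → Vec d} (h : Tame m Pr X) (hm : m ≤ m') : Tame m' Pr X where
  measurable ρ := (h.measurable ρ).mono hm le_rfl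
  dominated := by
    obtain ⟨W, hW, hW2, hb⟩ := h.dominated
    exact ⟨W, hW.mono hm le_rfl, hW2, hb⟩
  continuousAt := h.continuousAt

lemma Tame.const [IsFiniteMeasure Pr] (x : Vec d) : Tame m Pr (fun _ _ => x) where
  measurable _ := measurable_const
  dominated := ⟨fun _ => ‖x‖, measurable_const, memLp_const _, fun _ _ _ => le_rfl⟩
  continuousAt _ := continuousAt_const

lemma Tame.add {X Y : ℝ × ℝ → Ω → Vec d} (hX : Tame m Pr X) (hY : Tame m Pr Y) :
    Tame m Pr (fun ρ ω => X ρ ω + Y ρ ω) where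
  measurable ρ := (hX.measurable ρ).add (hY.measurable ρ)
  dominated := by
    obtain ⟨W, hW, hW2, hb⟩ := hX.dominated
    obtain ⟨V, hV, hV2, hb'⟩ := hY.dominated
    exact ⟨fun ω => W ω + V ω, hW.add hV, hW2.add hV2, fun ρ hρ ω =>
      (norm_add_le _ _).trans (add_le_add (hb ρ hρ ω) (hb' ρ hρ ω))⟩
  continuousAt ω := (hX.continuousAt ω).add (hY.continuousAt ω)

lemma Tame.smul {X : ℝ × ℝ → Ω → Vec d} (hX : Tame m Pr X) (c : ℝ) :
    Tame m Pr (fun ρ ω => c • X ρ ω) where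
  measurable ρ := (hX.measurable ρ).const_smul c
  dominated := by
    obtain ⟨W, hW, hW2, hb⟩ := hX.dominated
    refine ⟨fun ω => |c| * W ω, hW.const_mul _, hW2.const_mul _, fun ρ hρ ω => ?_⟩
    rw [norm_smul, Real.norm_eq_abs]
    exact mul_le_mul_of_nonneg_left (hb ρ hρ ω) (abs_nonneg c)
  continuousAt ω := (hX.continuousAt ω).const_smul c

lemma Tame.sub {X Y : ℝ × ℝ → Ω → Vec d} (hX : Tame m Pr X) (hY : Tame m Pr Y) :
    Tame m Pr (fun ρ ω => X ρ ω - Y ρ ω) := by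
  simpa [sub_eq_add_neg] using hX.add (hY.smul (-1))

lemma Tame.sum [IsFiniteMeasure Pr] {ι : Type*} (s : Finset ι) {X : ι → ℝ × ℝ → Ω → Vec d}
    (hX : ∀ i ∈ s, Tame m Pr (X i)) : Tame m Pr (fun ρ ω => ∑ i ∈ s, X i ρ ω) := by
  induction s using Finset.cons_induction with
  | empty => simpa using Tame.const 0
  | cons i s hi ih =>
    simp only [Finset.sum_cons]
    exact (hX i (by simp)).add (ih fun j hj => hX j (by simp [hj]))

lemma Tame.pivot [IsFiniteMeasure Pr] (hn : 1 ≤ n) (hL : 0 < L) (hf : SmoothConvex f L)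
    {X : ℝ × ℝ → Ω → Vec d} (hX : Tame m Pr X) :
    Tame m Pr (fun ρ ω => pivotEst f ρ.2 (X ρ ω)) where
  measurable ρ := (measurable_pivotEst hf ρ.2).comp (hX.measurable ρ)
  dominated := by
    obtain ⟨W, hW, hW2, hb⟩ := hX.dominated
    refine ⟨fun ω => d * L + ‖avgGrad f 0‖ + L * W ω, (hW.const_mul _).const_add _,
      (memLp_const (_ : ℝ)).add (hW2.const_mul _), fun ρ hρ ω => ?_⟩
    exact (norm_pivotEst_le hn hL hf ((norm_snd_le ρ).trans hρ) _).trans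
      (add_le_add le_rfl (mul_le_mul_of_nonneg_left (hb ρ hρ ω) hL.le))
  continuousAt ω := by
    have hc := hX.continuousAt ω
    rw [ContinuousAt, tendsto_iff_norm_sub_tendsto_zero] at hc ⊢
    have h1 : Filter.Tendsto (fun ρ : ℝ × ℝ => d * (L / 2 * |ρ.2|) + L * ‖X ρ ω - X 0 ω‖)
        (nhds 0) (nhds (d * (L / 2 * |(0 : ℝ × ℝ).2|) + L * 0)) := by
      refine Filter.Tendsto.add ?_ (hc.const_mul L)
      exact Continuous.tendsto (by fun_prop) _
    refine squeeze_zero (fun _ => norm_nonneg _) (fun ρ => ?_) (by simpa using h1)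
    refine (norm_sub_le_norm_sub_add_norm_sub _ (pivotEst f 0 (X ρ ω)) _).trans ?_
    refine add_le_add (norm_pivotEst_sub_le hn hf _ _) ?_
    simpa [pivotEst] using hf.avgGrad_lipschitz hn (X ρ ω) (X 0 ω)

lemma integrable_one_add_norm_pow_stdGaussian (k : ℕ) :
    Integrable (fun u : Vec d => (1 + ‖u‖) ^ k) (stdGaussian (Vec d)) := by
  have h1 : MemLp (fun u : Vec d => ‖u‖) k (stdGaussian (Vec d)) :=
    (IsGaussian.memLp_id (stdGaussian (Vec d)) k (ENNReal.natCast_ne_top k)).norm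
  have h2 : MemLp (fun u : Vec d => 1 + ‖u‖) k (stdGaussian (Vec d)) :=
    (memLp_const (1 : ℝ)).add h1
  refine h2.integrable_norm_pow'.congr (Filter.Eventually.of_forall fun u => ?_)
  have h3 : 0 ≤ 1 + ‖u‖ := by positivity
  simp only [Real.norm_eq_abs, abs_of_nonneg h3]

/-- Multiplying an `L²` function by an unbounded one leaves `L²` in general; here the squares are
independent and integrable, so their product is integrable. -/
lemma Fresh.memLp_mul [IsFiniteMeasure Pr] {ζ : Ω → Fin n × Vec d} (hζ : Fresh m Pr ζ)
    {W : Ω → ℝ} (hW : Measurable[m] W) (hW2 : MemLp W 2 Pr) (k : ℕ) :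
    MemLp (fun ω => W ω * (1 + ‖(ζ ω).2‖) ^ k) 2 Pr := by
  have hWm : Measurable W := hW.mono hζ.le le_rfl
  have hζm := hζ.measurable
  rw [memLp_two_iff_integrable_sq (by fun_prop)]
  have hA : Integrable (fun ω => W ω ^ 2) Pr := hW2.integrable_sq
  have hB : Integrable (fun ω => (1 + ‖(ζ ω).2‖) ^ (k * 2)) Pr := by
    have h3 := (integrable_one_add_norm_pow_stdGaussian (d := d) (k * 2)).comp_snd
      (uniformOn (Set.univ : Set (Fin n)))
    rw [← sampleLaw, ← hζ.law] at h3
    exact h3.comp_measurable hζ.measurable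
  have hind : IndepFun (fun ω => W ω ^ 2) (fun ω => (1 + ‖(ζ ω).2‖) ^ (k * 2)) Pr := by
    rw [IndepFun_iff_Indep]
    refine indep_of_indep_of_le_left (indep_of_indep_of_le_right hζ.indep ?_) ?_
    · exact Measurable.comap_le ((Measurable.pow_const (by fun_prop) _).comp
        (f := ζ) (g := fun ξ : Fin n × Vec d => (1 + ‖ξ.2‖) ^ (k * 2)) (comap_measurable ζ))
    · exact Measurable.comap_le (hW.pow_const 2)
  refine (hind.integrable_mul hA hB).congr (Filter.Eventually.of_forall fun ω => ?_)
  simp only [Pi.mul_apply]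
  ring

lemma Tame.dir [IsFiniteMeasure Pr] (hL : 0 < L) (hf : SmoothConvex f L)
    {ζ : Ω → Fin n × Vec d} (hζ : Fresh m Pr ζ) (hm : m ≤ m') (hζ' : Measurable[m'] ζ)
    {X : ℝ × ℝ → Ω → Vec d} (hX : Tame m Pr X) :
    Tame m' Pr (fun ρ ω => dirEst (f (ζ ω).1) ρ.1 (X ρ ω) (ζ ω).2) where
  measurable ρ := measurable_dirEst_comp hf ρ.1 ((hX.measurable ρ).mono hm le_rfl) hζ'
  dominated := by
    obtain ⟨W, hW, hW2, hb⟩ := hX.dominated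
    have hV : Measurable[m] (fun ω => ∑ j, ‖gradient (f j) 0‖ + L + L * W ω) :=
      (hW.const_mul L).const_add _
    have hV2 : MemLp (fun ω => ∑ j, ‖gradient (f j) 0‖ + L + L * W ω) 2 Pr :=
      (memLp_const (∑ j, ‖gradient (f j) 0‖ + L)).add (hW2.const_mul L)
    have hu : Measurable[m'] (fun ω => 1 + ‖(ζ ω).2‖) :=
      measurable_one_add_norm_snd hζ'
    refine ⟨fun ω => (∑ j, ‖gradient (f j) 0‖ + L + L * W ω) * (1 + ‖(ζ ω).2‖) ^ 3,
      (hV.mono hm le_rfl).mul (hu.pow_const 3), hζ.memLp_mul hV hV2 3, fun ρ hρ ω => ?_⟩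
    exact (norm_dirEst_le hL hf _ ((norm_fst_le ρ).trans hρ) _ _).trans
      (mul_le_mul_of_nonneg_right
        (add_le_add le_rfl (mul_le_mul_of_nonneg_left (hb ρ hρ ω) hL.le))
        (pow_nonneg (add_nonneg zero_le_one (norm_nonneg _)) 3))
  continuousAt ω := by
    have hc := hX.continuousAt ω
    rw [ContinuousAt, tendsto_iff_norm_sub_tendsto_zero] at hc ⊢
    have h1 : Filter.Tendsto (fun ρ : ℝ × ℝ => L / 2 * |ρ.1| * ‖(ζ ω).2‖ ^ 3
        + L * ‖X ρ ω - X 0 ω‖ * ‖(ζ ω).2‖ ^ 2)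
        (nhds 0) (nhds (L / 2 * |(0 : ℝ × ℝ).1| * ‖(ζ ω).2‖ ^ 3
          + L * 0 * ‖(ζ ω).2‖ ^ 2)) := by
      refine Filter.Tendsto.add ?_ ((hc.const_mul L).mul_const _)
      exact Continuous.tendsto (by fun_prop) _
    refine squeeze_zero (fun _ => norm_nonneg _) (fun ρ => ?_) (by simpa using h1)
    refine (norm_sub_le_norm_sub_add_norm_sub _
      (dirEst (f (ζ ω).1) 0 (X ρ ω) (ζ ω).2) _).trans ?_
    exact add_le_add (norm_dirEst_sub_le hf _ _ _ _) (norm_dirEst_zero_sub_le hf _ _ _ _)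

lemma abs_avg_le (hn : 1 ≤ n) (hf : SmoothConvex f L) (x : Vec d) :
    |avg f x| ≤ |avg f 0| + ‖avgGrad f 0‖ * ‖x‖ + L / 2 * ‖x‖ ^ 2 := by
  have h1 := abs_taylor_le hf.hasGradientAt_avg (hf.avgGrad_lipschitz hn) 0 x
  rw [zero_add] at h1
  have h2 := abs_real_inner_le_norm (avgGrad f 0) x
  have e : avg f x = (avg f x - avg f 0 - inner ℝ (avgGrad f 0) x) + avg f 0
    + inner ℝ (avgGrad f 0) x := by ring
  rw [e]
  refine (abs_add_three _ _ _).trans ?_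
  linarith

/-- The objective grows at most quadratically, which is why tameness asks for `L²` domination. -/
lemma Tame.exists_bound_avg [IsFiniteMeasure Pr] (hn : 1 ≤ n) (hL : 0 < L)
    (hf : SmoothConvex f L) {X : ℝ × ℝ → Ω → Vec d} (hX : Tame m Pr X) :
    ∃ V : Ω → ℝ, Integrable V Pr ∧ ∀ ρ, ‖ρ‖ ≤ 1 → ∀ ω, ‖avg f (X ρ ω)‖ ≤ V ω := by
  obtain ⟨W, -, hW2, hb⟩ := hX.dominated
  refine ⟨fun ω => |avg f 0| + ‖avgGrad f 0‖ * W ω + L / 2 * W ω ^ 2,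
    ((integrable_const _).add ((hW2.integrable (by norm_num)).const_mul _)).add
      (hW2.integrable_sq.const_mul _), fun ρ hρ ω => ?_⟩
  refine (abs_avg_le hn hf _).trans ?_
  have h1 := hb ρ hρ ω
  refine add_le_add (add_le_add le_rfl (mul_le_mul_of_nonneg_left h1 (norm_nonneg _))) ?_
  exact mul_le_mul_of_nonneg_left (pow_le_pow_left₀ (norm_nonneg _) h1 2) (by positivity)

lemma Tame.integrable_avg [IsFiniteMeasure Pr] (hn : 1 ≤ n) (hL : 0 < L)
    (hf : SmoothConvex f L) (hm : m ≤ m0) {X : ℝ × ℝ → Ω → Vec d} (hX : Tame m Pr X)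
    {ρ : ℝ × ℝ} (hρ : ‖ρ‖ ≤ 1) : Integrable (fun ω => avg f (X ρ ω)) Pr := by
  obtain ⟨V, hV, hb⟩ := hX.exists_bound_avg hn hL hf
  exact hV.mono' ((continuous_avg hf).measurable.comp
    ((hX.measurable ρ).mono hm le_rfl)).aestronglyMeasurable (Filter.Eventually.of_forall (hb ρ hρ))

lemma Tame.memLp (hm : m ≤ m0) {X : ℝ × ℝ → Ω → Vec d} (hX : Tame m Pr X)
    {ρ : ℝ × ℝ} (hρ : ‖ρ‖ ≤ 1) : MemLp (X ρ) 2 Pr := by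
  obtain ⟨W, -, hW2, hb⟩ := hX.dominated
  exact hW2.mono' ((hX.measurable ρ).mono hm le_rfl).aestronglyMeasurable
    (Filter.Eventually.of_forall (hb ρ hρ))

/-- The expected objective value of a tame family depends continuously on the smoothing
parameters at `0`. -/
lemma Tame.tendsto_integral_avg [IsFiniteMeasure Pr] (hn : 1 ≤ n) (hL : 0 < L)
    (hf : SmoothConvex f L) (hm : m ≤ m0) {X : ℝ × ℝ → Ω → Vec d} (hX : Tame m Pr X) :
    Filter.Tendsto (fun ρ => ∫ ω, avg f (X ρ ω) ∂Pr) (nhds 0) (nhds (∫ ω, avg f (X 0 ω) ∂Pr)) := by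
  obtain ⟨V, hV, hb⟩ := hX.exists_bound_avg hn hL hf
  refine tendsto_integral_filter_of_dominated_convergence V ?_ ?_ hV ?_
  · exact Filter.Eventually.of_forall fun ρ => ((continuous_avg hf).measurable.comp
      ((hX.measurable ρ).mono hm le_rfl)).aestronglyMeasurable
  · filter_upwards [Metric.closedBall_mem_nhds (0 : ℝ × ℝ) one_pos] with ρ hρ
    exact Filter.Eventually.of_forall (hb ρ (by simpa using hρ))
  · exact Filter.Eventually.of_forall fun ω =>
      ((continuous_avg hf).tendsto _).comp (hX.continuousAt ω)

end Tame

/-! ### The algorithm, extended to vanishing smoothing parameters -/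

section Extended

variable {n d : ℕ} {f : Fin n → Vec d → ℝ} {L : ℝ}

/-- The point `x̲_t` of the convex algorithm. -/
def lowerPoint (α : ℝ) (x xb xt : Vec d) : Vec d :=
  (1 - α - 1 / 2) • xb + α • x + (1 / 2 : ℝ) • xt

/-- One inner iteration on the pair `(x, x̄)`. -/
def stepAt (f : Fin n → Vec d → ℝ) (α γ μ : ℝ) (xt g : Vec d) (ξ : Fin n × Vec d)
    (p : Vec d × Vec d) : Vec d × Vec d :=
  let x := p.1 - γ • (dirEst (f ξ.1) μ (lowerPoint α p.1 p.2 xt) ξ.2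
    - dirEst (f ξ.1) μ xt ξ.2 + g)
  (x, lowerPoint α x p.2 xt)

/-- The pair `(x_t, x̄_t)` after `t` inner iterations. -/
def loopAt (f : Fin n → Vec d → ℝ) (α γ μ : ℝ) (x₀ xt g : Vec d) (ξ : ℕ → Fin n × Vec d) :
    ℕ → Vec d × Vec d
  | 0 => (x₀, xt)
  | t + 1 => stepAt f α γ μ xt g (ξ (t + 1)) (loopAt f α γ μ x₀ xt g ξ t)

/-- The weighted average of the points of an epoch. -/
def epochAverage (P : Params) (s : ℕ) (xb : ℕ → Vec d) : Vec d :=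
  (∑ t ∈ Finset.Icc 1 (P.T s), P.θ s t)⁻¹ • ∑ t ∈ Finset.Icc 1 (P.T s), P.θ s t • xb t

/-- The inner loop of epoch `s` started from the pair `(x, x̃)`. -/
def epochLoopAt (f : Fin n → Vec d → ℝ) (L : ℝ) (ρ : ℝ × ℝ) (s : ℕ) (ξ : ℕ → Fin n × Vec d)
    (p : Vec d × Vec d) : ℕ → Vec d × Vec d :=
  loopAt f (alpha n d s) (gam n d L s) ρ.1 p.1 p.2 (pivotEst f ρ.2 p.2) ξ

/-- The pair `(x^s, x̃^s)`. -/
def runAt (f : Fin n → Vec d → ℝ) (L : ℝ) (ρ : ℝ × ℝ) (x0 : Vec d)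
    (ξ : ℕ → ℕ → Fin n × Vec d) : ℕ → Vec d × Vec d
  | 0 => (x0, x0)
  | s + 1 =>
    let it := epochLoopAt f L ρ (s + 1) (ξ (s + 1)) (runAt f L ρ x0 ξ s)
    ((it (epochLength n d (s + 1))).1,
      epochAverage (convexParams n d L) (s + 1) (fun t => (it t).2))

lemma innerLoop_eq_loopAt {μ : ℝ} (hμ : μ ≠ 0) (s : ℕ) (x₀ xt g : Vec d)
    (ξ : ℕ → Fin n × Vec d) (t : ℕ) :
    ((innerLoop f (convexParams n d L) μ s x₀ xt g ξ t).x,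
      (innerLoop f (convexParams n d L) μ s x₀ xt g ξ t).xbar)
        = loopAt f (alpha n d s) (gam n d L s) μ x₀ xt g ξ t := by
  induction t with
  | zero => rfl
  | succ t ih =>
    rw [loopAt, ← ih]
    simp [innerLoop, innerStep, stepAt, convexParams, lowerPoint, dirEst, hμ]

/-- The extension alters the algorithm only at vanishing parameters, so properties of `runAt` near
`ρ = 0` apply to the actual run. -/
lemma run_eq_runAt {μ ν : ℝ} (hμ : μ ≠ 0) (hν : ν ≠ 0) (x0 : Vec d)
    (ξ : ℕ → ℕ → Fin n × Vec d) (s : ℕ) :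
    ((run f (convexParams n d L) μ ν x0 ξ s).x, (run f (convexParams n d L) μ ν x0 ξ s).xtilde)
      = runAt f L (μ, ν) x0 ξ s := by
  induction s with
  | zero => rfl
  | succ s ih =>
    rw [runAt, ← ih]
    simp only [epochLoopAt, pivotEst, if_neg hν, ← innerLoop_eq_loopAt hμ]
    rfl

lemma approx_eq_runAt {μ ν : ℝ} (hμ : μ ≠ 0) (hν : ν ≠ 0) (x0 : Vec d)
    (ξ : ℕ → ℕ → Fin n × Vec d) (s : ℕ) :
    approx f L μ ν x0 ξ s = (runAt f L (μ, ν) x0 ξ s).2 := by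
  rw [← run_eq_runAt hμ hν]
  rfl

lemma innerLoop_queries (P : Params) (μ : ℝ) (s : ℕ) (x₀ xt g : Vec d)
    (ξ : ℕ → Fin n × Vec d) (t : ℕ) : (innerLoop f P μ s x₀ xt g ξ t).queries = 4 * t := by
  induction t with
  | zero => rfl
  | succ t ih =>
    simp only [innerLoop, innerStep, gaussCost, ih]
    ring

lemma numQueries_eq (μ ν : ℝ) (x0 : Vec d) (ξ : ℕ → ℕ → Fin n × Vec d) (S : ℕ) :
    numQueries f L μ ν x0 ξ S
      = ∑ s ∈ Finset.range S, (2 * d * n + 4 * epochLength n d (s + 1)) := by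
  induction S with
  | zero => rfl
  | succ S ih =>
    rw [Finset.sum_range_succ, ← ih]
    simp only [numQueries, run, epoch, innerLoop_queries, coordCost]
    simp only [convexParams]
    ring

lemma epochLength_pos (s : ℕ) : 1 ≤ epochLength n d s := by
  unfold epochLength
  split <;> exact Nat.one_le_two_pow

end Extended

/-! ### The filtration of the samples, and tameness of the run -/

section Filtration

variable {n d : ℕ} {f : Fin n → Vec d → ℝ} {L : ℝ} {Ω : Type*} {ξ : ℕ → ℕ → Ω → Fin n × Vec d}

/-- The σ-algebra of the samples up to inner iteration `t` of epoch `s`. -/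
@[reducible] def past (ξ : ℕ → ℕ → Ω → Fin n × Vec d) (s t : ℕ) : MeasurableSpace Ω :=
  ⨆ k ∈ {k : ℕ × ℕ | k.1 < s ∨ k.1 = s ∧ k.2 ≤ t}, MeasurableSpace.comap (ξ k.1 k.2) inferInstance

lemma past_mono {s s' t t' : ℕ} (h : s < s' ∨ s = s' ∧ t ≤ t') : past ξ s t ≤ past ξ s' t' := by
  refine iSup₂_le fun k hk => le_iSup₂ (f := fun (k : ℕ × ℕ)
    (_ : k ∈ {k : ℕ × ℕ | k.1 < s' ∨ k.1 = s' ∧ k.2 ≤ t'}) =>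
      MeasurableSpace.comap (ξ k.1 k.2) inferInstance) k ?_
  simp only [Set.mem_ofPred_eq] at hk ⊢
  omega

lemma measurable_past (s t : ℕ) : Measurable[past ξ s t] (ξ s t) := by
  rw [measurable_iff_comap_le]
  exact le_iSup₂ (f := fun (k : ℕ × ℕ)
    (_ : k ∈ {k : ℕ × ℕ | k.1 < s ∨ k.1 = s ∧ k.2 ≤ t}) =>
      MeasurableSpace.comap (ξ k.1 k.2) inferInstance) (s, t) (by simp)

variable {m : MeasurableSpace Ω} [m0 : MeasurableSpace Ω] {Pr : Measure Ω}

lemma IsSampling.past_le (hξ : IsSampling Pr ξ) (s t : ℕ) : past ξ s t ≤ m0 :=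
  iSup₂_le fun k _ => (hξ.measurable k.1 k.2).comap_le

lemma IsSampling.fresh (hξ : IsSampling Pr ξ) (s t : ℕ) :
    Fresh (past ξ s t) Pr (ξ s (t + 1)) where
  le := hξ.past_le s t
  measurable := hξ.measurable _ _
  law := hξ.law _ _
  indep := by
    have hdisj : Disjoint {k : ℕ × ℕ | k.1 < s ∨ k.1 = s ∧ k.2 ≤ t} {(s, t + 1)} := by
      simp
    have h := indep_iSup_of_disjoint (fun k : ℕ × ℕ => (hξ.measurable k.1 k.2).comap_le)
      hξ.indep.iIndep hdisj
    rw [iSup_singleton] at h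
    exact h

lemma Tame.lowerPoint [IsFiniteMeasure Pr] {X Xb Xt : ℝ × ℝ → Ω → Vec d}
    (hX : Tame m Pr X) (hXb : Tame m Pr Xb) (hXt : Tame m Pr Xt) (α : ℝ) :
    Tame m Pr (fun ρ ω => ZOVarag.lowerPoint α (X ρ ω) (Xb ρ ω) (Xt ρ ω)) :=
  ((hXb.smul _).add (hX.smul _)).add (hXt.smul _)

lemma Tame.loopAt [IsFiniteMeasure Pr] (hn : 1 ≤ n) (hL : 0 < L) (hf : SmoothConvex f L)
    (hξ : IsSampling Pr ξ) {s : ℕ} {X Xt : ℝ × ℝ → Ω → Vec d}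
    (hX : Tame (past ξ s 0) Pr X) (hXt : Tame (past ξ s 0) Pr Xt) (α γ : ℝ) (t : ℕ) :
    Tame (past ξ s t) Pr (fun ρ ω => (ZOVarag.loopAt f α γ ρ.1 (X ρ ω) (Xt ρ ω)
      (pivotEst f ρ.2 (Xt ρ ω)) (fun t => ξ s t ω) t).1) ∧
    Tame (past ξ s t) Pr (fun ρ ω => (ZOVarag.loopAt f α γ ρ.1 (X ρ ω) (Xt ρ ω)
      (pivotEst f ρ.2 (Xt ρ ω)) (fun t => ξ s t ω) t).2) := by
  induction t with
  | zero => exact ⟨hX, hXt⟩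
  | succ t ih =>
    obtain ⟨h1, h2⟩ := ih
    have hm : past ξ s t ≤ past ξ s (t + 1) := past_mono (by omega)
    have h0 : Tame (past ξ s t) Pr Xt := hXt.mono (past_mono (by omega))
    have h3 := (h1.lowerPoint h2 h0 α).dir hL hf (hξ.fresh s t) hm (measurable_past s (t + 1))
    have h4 := h0.dir hL hf (hξ.fresh s t) hm (measurable_past s (t + 1))
    have h5 := (h0.mono hm).pivot hn hL hf
    have h6 := (h1.mono hm).sub (((h3.sub h4).add h5).smul γ)
    exact ⟨h6, h6.lowerPoint (h2.mono hm) (h0.mono hm) α⟩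

/-- Each operation of the algorithm preserves tameness, so this holds for any fixed number of
epochs. The dominating function depends on `s`, and no uniformity in `s` is claimed. -/
lemma Tame.runAt [IsFiniteMeasure Pr] (hn : 1 ≤ n) (hL : 0 < L) (hf : SmoothConvex f L)
    (hξ : IsSampling Pr ξ) (x0 : Vec d) (s : ℕ) :
    Tame (past ξ (s + 1) 0) Pr (fun ρ ω => (ZOVarag.runAt f L ρ x0 (fun s t => ξ s t ω) s).1) ∧
    Tame (past ξ (s + 1) 0) Pr (fun ρ ω => (ZOVarag.runAt f L ρ x0 (fun s t => ξ s t ω) s).2) := by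
  induction s with
  | zero => exact ⟨Tame.const x0, Tame.const x0⟩
  | succ s ih =>
    have h := fun t => Tame.loopAt hn hL hf hξ ih.1 ih.2 (alpha n d (s + 1)) (gam n d L (s + 1)) t
    refine ⟨(h (epochLength n d (s + 1))).1.mono (past_mono (by omega)), ?_⟩
    refine Tame.smul (Tame.sum _ fun t _ => Tame.smul ((h t).2.mono (past_mono (by omega))) _) _

end Filtration

/-! ### One inner iteration of the limiting algorithm -/

section OneStep

variable {n d : ℕ} {f : Fin n → Vec d → ℝ} {L : ℝ}

lemma integrable_inner_add_norm_sq_estimate (hn : 1 ≤ n) (a : Fin n → Vec d) (c v : Vec d)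
    (κ : ℝ) : Integrable (fun ξ : Fin n × Vec d =>
      inner ℝ v ((inner ℝ (a ξ.1) ξ.2 : ℝ) • ξ.2 + c)
        + κ * ‖(inner ℝ (a ξ.1) ξ.2 : ℝ) • ξ.2 + c‖ ^ 2) (sampleLaw n d) := by
  refine integrable_sampleLaw hn (φ := fun i u => inner ℝ v ((inner ℝ (a i) u : ℝ) • u + c)
        + κ * ‖(inner ℝ (a i) u : ℝ) • u + c‖ ^ 2) (fun i => ?_) (fun i => by fun_prop)
  have h1 : Integrable (fun u => (inner ℝ (a i) u : ℝ) • u + c) (stdGaussian (Vec d)) :=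
    (integrable_inner_smul_stdGaussian (a i)).add (integrable_const c)
  have h2 : MemLp (fun u => (inner ℝ (a i) u : ℝ) • u) 2 (stdGaussian (Vec d)) := by
    rw [memLp_two_iff_integrable_sq_norm (by fun_prop)]
    exact integrable_norm_sq_inner_smul_stdGaussian (a i)
  have h3 := (h2.add (memLp_const c)).integrable_norm_pow two_ne_zero
  exact (h1.const_inner v).add (h3.const_mul κ)

/-- The estimate `⟨a_i, u⟩ u + c` has mean `g`, and its second moment splits into that of the random
part and terms in `c` and `g`. -/
lemma integral_inner_add_norm_sq_estimate_le (hn : 1 ≤ n) (a : Fin n → Vec d) (c v g : Vec d)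
    {κ : ℝ} (hκ : 0 ≤ κ) (hg : (1 / (n : ℝ)) • ∑ i, a i + c = g) :
    ∫ ξ, (inner ℝ v ((inner ℝ (a ξ.1) ξ.2 : ℝ) • ξ.2 + c)
        + κ * ‖(inner ℝ (a ξ.1) ξ.2 : ℝ) • ξ.2 + c‖ ^ 2) ∂(sampleLaw n d)
      ≤ inner ℝ v g + κ * (‖g‖ ^ 2 + 3 * d * (1 / (n : ℝ) * ∑ i, ‖a i‖ ^ 2)) := by
  have hn' : (0 : ℝ) < n := by exact_mod_cast hn
  have e : ∀ (i : Fin n) (u : Vec d), inner ℝ v ((inner ℝ (a i) u : ℝ) • u + c)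
        + κ * ‖(inner ℝ (a i) u : ℝ) • u + c‖ ^ 2
      = (inner ℝ (v + (2 * κ) • c) ((inner ℝ (a i) u : ℝ) • u)
        + κ * ‖(inner ℝ (a i) u : ℝ) • u‖ ^ 2) + (inner ℝ v c + κ * ‖c‖ ^ 2) := by
    intro i u
    rw [norm_add_sq_real, inner_add_left, inner_add_right, real_inner_smul_left c,
      real_inner_comm ((inner ℝ (a i) u : ℝ) • u) c]
    ring
  have h1 : ∀ i, Integrable (fun u => inner ℝ (v + (2 * κ) • c) ((inner ℝ (a i) u : ℝ) • u))
      (stdGaussian (Vec d)) := fun i => (integrable_inner_smul_stdGaussian (a i)).const_inner _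
  have h2 : ∀ i, Integrable (fun u => κ * ‖(inner ℝ (a i) u : ℝ) • u‖ ^ 2)
      (stdGaussian (Vec d)) :=
    fun i => (integrable_norm_sq_inner_smul_stdGaussian (a i)).const_mul κ
  have h12 : ∀ i, Integrable (fun u => inner ℝ (v + (2 * κ) • c) ((inner ℝ (a i) u : ℝ) • u)
      + κ * ‖(inner ℝ (a i) u : ℝ) • u‖ ^ 2) (stdGaussian (Vec d)) :=
    fun i => (h1 i).add (h2 i)
  simp_rw [e]
  rw [integral_sampleLaw hn (φ := fun i u =>
    (inner ℝ (v + (2 * κ) • c) ((inner ℝ (a i) u : ℝ) • u)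
        + κ * ‖(inner ℝ (a i) u : ℝ) • u‖ ^ 2) + (inner ℝ v c + κ * ‖c‖ ^ 2))
    (fun i => (h12 i).add (integrable_const _)) (fun i => by fun_prop)]
  have h3 : ∀ i, ∫ u, ((inner ℝ (v + (2 * κ) • c) ((inner ℝ (a i) u : ℝ) • u)
        + κ * ‖(inner ℝ (a i) u : ℝ) • u‖ ^ 2) + (inner ℝ v c + κ * ‖c‖ ^ 2))
          ∂(stdGaussian (Vec d))
      ≤ inner ℝ (v + (2 * κ) • c) (a i) + κ * (3 * d * ‖a i‖ ^ 2)
        + (inner ℝ v c + κ * ‖c‖ ^ 2) := by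
    intro i
    rw [integral_add (h12 i) (integrable_const _), integral_add (h1 i) (h2 i),
      integral_inner (integrable_inner_smul_stdGaussian (a i)), integral_inner_smul_stdGaussian,
      integral_const_mul]
    have := integral_norm_sq_inner_smul_stdGaussian_le (a i)
    simp only [integral_const, probReal_univ, one_smul]
    gcongr
  have h4 : (1 / (n : ℝ)) * ∑ i, inner ℝ (v + (2 * κ) • c) (a i)
      = inner ℝ (v + (2 * κ) • c) (g - c) := by
    rw [← hg, add_sub_cancel_right, real_inner_smul_right, inner_sum]
  have h5 : ‖g‖ ^ 2 = ‖g - c‖ ^ 2 + 2 * inner ℝ c (g - c) + ‖c‖ ^ 2 := by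
    have := norm_add_sq_real (g - c) c
    rw [sub_add_cancel, real_inner_comm] at this
    exact this
  calc _ ≤ (1 / (n : ℝ)) * ∑ i, (inner ℝ (v + (2 * κ) • c) (a i) + κ * (3 * d * ‖a i‖ ^ 2)
        + (inner ℝ v c + κ * ‖c‖ ^ 2)) := by
        rw [smul_eq_mul]
        gcongr with i
        exact h3 i
    _ = inner ℝ (v + (2 * κ) • c) (g - c) + κ * (3 * d * (1 / (n : ℝ) * ∑ i, ‖a i‖ ^ 2))
        + (inner ℝ v c + κ * ‖c‖ ^ 2) := by
        rw [Finset.sum_add_distrib, Finset.sum_add_distrib, mul_add, mul_add, h4, ← Finset.mul_sum,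
          ← Finset.mul_sum]
        simp only [Finset.sum_const, Finset.card_univ, Fintype.card_fin, nsmul_eq_mul]
        field_simp
    -- Only the term `-κ ‖g - c‖²` is discarded.
    _ ≤ _ := by
        rw [mul_add, h5, inner_add_left, real_inner_smul_left, inner_sub_right v]
        nlinarith [mul_nonneg hκ (sq_nonneg ‖g - c‖)]

/-- The points `x̄_t` and `x̲_t` differ only in using `x_t` or `x_{t-1}`, so `x̄_t` is a step of
length `αγ` from `x̲_t`. -/
lemma lowerPoint_sub_smul (α γ : ℝ) (x xb xt G : Vec d) :
    lowerPoint α (x - γ • G) xb xt = lowerPoint α x xb xt + (-(α * γ)) • G := by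
  simp only [lowerPoint, smul_sub, smul_smul, neg_smul]
  abel

lemma dirEst_zero_sub (h : Vec d → ℝ) (x y u : Vec d) :
    dirEst h 0 x u - dirEst h 0 y u = (inner ℝ (gradient h x - gradient h y) u : ℝ) • u := by
  simp only [dirEst, if_pos]
  rw [← sub_smul, ← inner_sub_left]

/-- The quantity controlled in one inner iteration from the state `(x, x̄, x̃)`. -/
def stepPotential (f : Fin n → Vec d → ℝ) (α γ : ℝ) (z : Vec d)
    (q : (Vec d × Vec d × Vec d) × (Fin n × Vec d)) : ℝ :=
  avg f (stepAt f α γ 0 q.1.2.2 (pivotEst f 0 q.1.2.2) q.2 (q.1.1, q.1.2.1)).2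
    + α / (2 * γ)
      * ‖(stepAt f α γ 0 q.1.2.2 (pivotEst f 0 q.1.2.2) q.2 (q.1.1, q.1.2.1)).1 - z‖ ^ 2

lemma measurable_stepPotential (hf : SmoothConvex f L) (α γ : ℝ) (z : Vec d) :
    Measurable (stepPotential f α γ z) := by
  have h1 := (continuous_avg hf).measurable
  have h2 := measurable_pivotEst hf 0
  have h3 : Measurable (fun q : (Vec d × Vec d × Vec d) × (Fin n × Vec d) =>
      dirEst (f q.2.1) 0 (lowerPoint α q.1.1 q.1.2.1 q.1.2.2) q.2.2) :=
    measurable_dirEst_comp hf 0 (by unfold lowerPoint; fun_prop) measurable_snd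
  have h4 : Measurable (fun q : (Vec d × Vec d × Vec d) × (Fin n × Vec d) =>
      dirEst (f q.2.1) 0 q.1.2.2 q.2.2) :=
    measurable_dirEst_comp hf 0 (by fun_prop) measurable_snd
  have h5 : Measurable (fun q : (Vec d × Vec d × Vec d) × (Fin n × Vec d) =>
      (stepAt f α γ 0 q.1.2.2 (pivotEst f 0 q.1.2.2) q.2 (q.1.1, q.1.2.1)).1) := by
    simp only [stepAt]
    fun_prop
  have h6 : Measurable (fun q : (Vec d × Vec d × Vec d) × (Fin n × Vec d) =>
      (stepAt f α γ 0 q.1.2.2 (pivotEst f 0 q.1.2.2) q.2 (q.1.1, q.1.2.1)).2) := by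
    simp only [stepAt, lowerPoint]
    simp only [lowerPoint] at h3
    fun_prop
  unfold stepPotential
  fun_prop

/-- Serves only for integrability, by sandwiching. The term with factor `0` gives the bound the same
shape as the upper one, so one integrability lemma covers both. -/
lemma le_stepPotential (hf : SmoothConvex f L) {α γ : ℝ} (hα : 0 < α) (hγ : 0 < γ)
    (x xb xt z : Vec d) (ξ : Fin n × Vec d) (xl : Vec d) (hxl : xl = lowerPoint α x xb xt) :
    (inner ℝ (-(α * γ) • avgGrad f xl)
        ((inner ℝ (gradient (f ξ.1) xl - gradient (f ξ.1) xt) ξ.2 : ℝ) • ξ.2 + avgGrad f xt)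
      + 0 * ‖(inner ℝ (gradient (f ξ.1) xl - gradient (f ξ.1) xt) ξ.2 : ℝ) • ξ.2
          + avgGrad f xt‖ ^ 2) + avg f xl ≤ stepPotential f α γ z ((x, xb, xt), ξ) := by
  simp only [stepPotential, stepAt]
  rw [lowerPoint_sub_smul, ← hxl, dirEst_zero_sub]
  have hp : pivotEst f 0 xt = avgGrad f xt := by simp [pivotEst]
  rw [hp]
  set G := (inner ℝ (gradient (f ξ.1) xl - gradient (f ξ.1) xt) ξ.2 : ℝ) • ξ.2 + avgGrad f xt
  have h1 := convex_gradient_le hf.hasGradientAt_avg hf.convexOn_avg xl (xl + (-(α * γ)) • G)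
  rw [add_sub_cancel_left, real_inner_smul_right] at h1
  rw [real_inner_smul_left, zero_mul, add_zero]
  have h2 : 0 ≤ α / (2 * γ) * ‖x - γ • G - z‖ ^ 2 := by positivity
  linarith

/-- Descent from `x̲_t` to `x̄_t`, plus the expanded square of `x_t - z`. The result is affine in
`G` and `‖G‖²`, whose expectations are under control. -/
lemma stepPotential_le (hn : 1 ≤ n) (hf : SmoothConvex f L) {α γ : ℝ} (hγ : 0 < γ)
    (x xb xt z : Vec d) (ξ : Fin n × Vec d) (xl : Vec d) (hxl : xl = lowerPoint α x xb xt) :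
    stepPotential f α γ z ((x, xb, xt), ξ) ≤
      (inner ℝ (-(α * γ) • avgGrad f xl - α • (x - z))
        ((inner ℝ (gradient (f ξ.1) xl - gradient (f ξ.1) xt) ξ.2 : ℝ) • ξ.2 + avgGrad f xt)
      + (L / 2 * (α * γ) ^ 2 + α * γ / 2)
        * ‖(inner ℝ (gradient (f ξ.1) xl - gradient (f ξ.1) xt) ξ.2 : ℝ) • ξ.2
          + avgGrad f xt‖ ^ 2)
      + (avg f xl + α / (2 * γ) * ‖x - z‖ ^ 2) := by
  simp only [stepPotential, stepAt]
  rw [lowerPoint_sub_smul, ← hxl, dirEst_zero_sub]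
  have hp : pivotEst f 0 xt = avgGrad f xt := by simp [pivotEst]
  rw [hp]
  set G := (inner ℝ (gradient (f ξ.1) xl - gradient (f ξ.1) xt) ξ.2 : ℝ) • ξ.2 + avgGrad f xt
  have h1 := descent hf.hasGradientAt_avg (hf.avgGrad_lipschitz hn) xl (-(α * γ) • G)
  rw [norm_smul, mul_pow, Real.norm_eq_abs, sq_abs, real_inner_smul_right] at h1
  have h2 : x - γ • G - z = (x - z) - γ • G := by abel
  rw [h2, norm_sub_sq_real, norm_smul, mul_pow, Real.norm_eq_abs, sq_abs, real_inner_smul_right,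
    inner_sub_left (-(α * γ) • avgGrad f xl), real_inner_smul_left, real_inner_smul_left]
  have h3 : α / (2 * γ) * (‖x - z‖ ^ 2 - 2 * (γ * inner ℝ (x - z) G) + γ ^ 2 * ‖G‖ ^ 2)
      = α / (2 * γ) * ‖x - z‖ ^ 2 - α * inner ℝ (x - z) G + α * γ / 2 * ‖G‖ ^ 2 := by
    field_simp
  rw [h3]
  nlinarith

/-- Convexity at `x̲_t` is applied towards `x̄` and `z`, but towards `x̃` the Bregman gap `B` is
kept. Half of it absorbs the variance, and the descent term absorbs `κ ‖∇f(x̲_t)‖²`. -/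
lemma integral_stepPotential_le (hn : 1 ≤ n) (hL : 0 < L) (hf : SmoothConvex f L) {α γ : ℝ}
    (hα : 0 < α) (hα2 : α ≤ 1 / 2) (hγ : 0 < γ) (hαγ : α * γ = 1 / (12 * ((d : ℝ) + 4) * L))
    (x xb xt z : Vec d) :
    ∫ ξ, stepPotential f α γ z ((x, xb, xt), ξ) ∂(sampleLaw n d)
      ≤ (1 / 2 - α) * avg f xb + α * avg f z + 1 / 2 * avg f xt
        + α / (2 * γ) * ‖x - z‖ ^ 2 := by
  have hn' : (0 : ℝ) < n := by exact_mod_cast hn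
  set xl := lowerPoint α x xb xt with hxl
  set v := -(α * γ) • avgGrad f xl - α • (x - z) with hv
  set κ := L / 2 * (α * γ) ^ 2 + α * γ / 2 with hκ
  set K := avg f xl + α / (2 * γ) * ‖x - z‖ ^ 2 with hK
  have hκ0 : 0 ≤ κ := by positivity
  have hprob := isProbabilityMeasure_sampleLaw (d := d) hn
  have hi := integrable_inner_add_norm_sq_estimate hn
    (fun i => gradient (f i) xl - gradient (f i) xt) (avgGrad f xt) v κ
  have hg : (1 / (n : ℝ)) • ∑ i, (gradient (f i) xl - gradient (f i) xt) + avgGrad f xt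
      = avgGrad f xl := by
    rw [Finset.sum_sub_distrib, smul_sub, avgGrad, avgGrad, sub_add_cancel]
  have h1 := integral_inner_add_norm_sq_estimate_le hn
    (fun i => gradient (f i) xl - gradient (f i) xt) (avgGrad f xt) v (avgGrad f xl) hκ0 hg
  have h2 : ∫ ξ, stepPotential f α γ z ((x, xb, xt), ξ) ∂(sampleLaw n d)
      ≤ ∫ ξ, ((inner ℝ v
        ((inner ℝ (gradient (f ξ.1) xl - gradient (f ξ.1) xt) ξ.2 : ℝ) • ξ.2 + avgGrad f xt)
      + κ * ‖(inner ℝ (gradient (f ξ.1) xl - gradient (f ξ.1) xt) ξ.2 : ℝ) • ξ.2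
          + avgGrad f xt‖ ^ 2) + K) ∂(sampleLaw n d) := by
    have hj := (integrable_inner_add_norm_sq_estimate hn
      (fun i => gradient (f i) xl - gradient (f i) xt) (avgGrad f xt)
      (-(α * γ) • avgGrad f xl) 0).add (integrable_const (avg f xl))
    have hk := hi.add (integrable_const K)
    have hup := fun ξ => stepPotential_le hn hf (α := α) hγ x xb xt z ξ xl hxl
    have hlow := fun ξ => le_stepPotential hf hα hγ x xb xt z ξ xl hxl
    have hm : Measurable (fun ξ => stepPotential f α γ z ((x, xb, xt), ξ)) :=
      (measurable_stepPotential hf α γ z).comp measurable_prodMk_left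
    exact integral_mono (integrable_of_le_of_le hm.aestronglyMeasurable
      (Filter.Eventually.of_forall hlow) (Filter.Eventually.of_forall hup) hj hk) hk hup
  rw [integral_add hi (integrable_const K)] at h2
  simp only [integral_const, probReal_univ, one_smul] at h2
  have h3 := avg_cocoercive hL hf xl xt
  set B := avg f xt - avg f xl - inner ℝ (avgGrad f xl) (xt - xl) with hB
  have hB0 : 0 ≤ B := by
    have := convex_gradient_le hf.hasGradientAt_avg hf.convexOn_avg xl xt
    linarith
  have h4 := convex_gradient_le hf.hasGradientAt_avg hf.convexOn_avg xl xb
  have h5 := convex_gradient_le hf.hasGradientAt_avg hf.convexOn_avg xl z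
  -- This is the definition of `x̲_t` as a convex combination, rewritten relative to `x̲_t`.
  have h6 : α * inner ℝ (avgGrad f xl) (z - x)
      = (1 / 2 - α) * inner ℝ (avgGrad f xl) (xb - xl) + α * inner ℝ (avgGrad f xl) (z - xl)
        + 1 / 2 * inner ℝ (avgGrad f xl) (xt - xl) := by
    simp only [← real_inner_smul_right, ← inner_add_right]
    congr 1
    rw [hxl, lowerPoint]
    module
  have h7 : inner ℝ v (avgGrad f xl)
      = -(α * γ) * ‖avgGrad f xl‖ ^ 2 + α * inner ℝ (avgGrad f xl) (z - x) := by
    rw [hv, inner_sub_left, real_inner_smul_left, real_inner_smul_left, real_inner_self_eq_norm_sq,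
      real_inner_comm, inner_sub_right, inner_sub_right]
    ring
  have hd : (0 : ℝ) ≤ d := d.cast_nonneg
  have hLβ : L * (α * γ) ≤ 1 := by
    rw [hαγ, mul_one_div, div_le_one (by positivity)]
    nlinarith
  -- The `12` in `γ_s`: the variance is at most `αγ · 3d · 2L · B`, and the budget is `B / 2`.
  have hdLβ : 12 * d * L * (α * γ) ≤ 1 := by
    rw [hαγ, mul_one_div, div_le_one (by positivity)]
    nlinarith
  have hβ : 0 < α * γ := by positivity
  have h8 : κ ≤ α * γ := by rw [hκ]; nlinarith
  have h9 : κ * (3 * d * (1 / (n : ℝ) * ∑ i, ‖gradient (f i) xl - gradient (f i) xt‖ ^ 2))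
      ≤ 1 / 2 * B := by
    calc _ ≤ (α * γ) * (3 * d * (2 * L * B)) := by gcongr
      _ = 12 * d * L * (α * γ) * (1 / 2 * B) := by ring
      _ ≤ 1 * (1 / 2 * B) := by gcongr
      _ = _ := one_mul _
  have h10 : κ * ‖avgGrad f xl‖ ^ 2 ≤ α * γ * ‖avgGrad f xl‖ ^ 2 := by gcongr
  have h11 := mul_le_mul_of_nonneg_left h4 (sub_nonneg.2 hα2)
  have h12 := mul_le_mul_of_nonneg_left h5 hα.le
  rw [mul_add] at h1
  linarith

end OneStep

/-! ### Integrating out a fresh sample -/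

section Expectation

variable {n d : ℕ} {f : Fin n → Vec d → ℝ} {L : ℝ} {Ω : Type*} {m : MeasurableSpace Ω}
  [m0 : MeasurableSpace Ω] {Pr : Measure Ω}

/-- Independence makes the joint law of past and sample a product, so Fubini replaces conditional
expectations: a bound for each frozen past state integrates. -/
lemma Fresh.integral_le {E : Type*} [MeasurableSpace E] [IsProbabilityMeasure Pr]
    {ζ : Ω → Fin n × Vec d} (hζ : Fresh m Pr ζ) {Y : Ω → E} (hY : Measurable[m] Y)
    {φ : E × (Fin n × Vec d) → ℝ} (hφ : Measurable φ) {Φ : E → ℝ}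
    (hle : ∀ y, ∫ ζ, φ (y, ζ) ∂(sampleLaw n d) ≤ Φ y)
    (hi : Integrable (fun ω => φ (Y ω, ζ ω)) Pr) (hΦ : Integrable (fun ω => Φ (Y ω)) Pr) :
    ∫ ω, φ (Y ω, ζ ω) ∂Pr ≤ ∫ ω, Φ (Y ω) ∂Pr := by
  have hYm : Measurable Y := hY.mono hζ.le le_rfl
  have hζm := hζ.measurable
  have hind : IndepFun Y ζ Pr := by
    rw [IndepFun_iff_Indep]
    exact indep_of_indep_of_le_left hζ.indep hY.comap_le
  have hmap := (indepFun_iff_map_prod_eq_prod_map_map hYm.aemeasurable hζm.aemeasurable).1 hind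
  rw [hζ.law] at hmap
  have : IsProbabilityMeasure (sampleLaw n d) := by
    rw [← hζ.law]
    exact Measure.isProbabilityMeasure_map hζm.aemeasurable
  have : IsProbabilityMeasure (Pr.map Y) := Measure.isProbabilityMeasure_map hYm.aemeasurable
  have hi2 : Integrable φ ((Pr.map Y).prod (sampleLaw n d)) := by
    rw [← hmap, integrable_map_measure hφ.aestronglyMeasurable (by fun_prop)]
    exact hi
  have hl := hi2.integral_prod_left
  have e1 : ∫ ω, φ (Y ω, ζ ω) ∂Pr = ∫ y, ∫ ζ, φ (y, ζ) ∂(sampleLaw n d) ∂(Pr.map Y) := by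
    rw [← integral_prod φ hi2, ← hmap, integral_map (by fun_prop) hφ.aestronglyMeasurable]
  rw [e1, integral_map hYm.aemeasurable hl.aestronglyMeasurable]
  exact integral_mono (hl.comp_measurable hYm) hΦ fun ω => hle (Y ω)

end Expectation

/-! ### Convergence of the limiting algorithm -/

section Epochs

variable {n d : ℕ} {f : Fin n → Vec d → ℝ} {L : ℝ} {Ω : Type*} {m : MeasurableSpace Ω}
  [m0 : MeasurableSpace Ω] {Pr : Measure Ω} {ξ : ℕ → ℕ → Ω → Fin n × Vec d}

lemma Tame.integrable_norm_sub_sq [IsFiniteMeasure Pr] (hm : m ≤ m0) {X : ℝ × ℝ → Ω → Vec d}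
    (hX : Tame m Pr X) (z : Vec d) : Integrable (fun ω => ‖X 0 ω - z‖ ^ 2) Pr :=
  ((hX.sub (Tame.const z)).memLp hm (ρ := 0) (by simp)).integrable_norm_pow two_ne_zero

lemma expected_step_le [IsProbabilityMeasure Pr] (hn : 1 ≤ n) (hL : 0 < L)
    (hf : SmoothConvex f L) (hξ : IsSampling Pr ξ) {α γ : ℝ} (hα : 0 < α) (hα2 : α ≤ 1 / 2)
    (hγ : 0 < γ) (hαγ : α * γ = 1 / (12 * ((d : ℝ) + 4) * L)) {s : ℕ}
    {X Xt : ℝ × ℝ → Ω → Vec d} (hX : Tame (past ξ s 0) Pr X) (hXt : Tame (past ξ s 0) Pr Xt)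
    {p : ℕ → Ω → Vec d × Vec d} (hp : ∀ t ω, p t ω = loopAt f α γ 0 (X 0 ω) (Xt 0 ω)
      (pivotEst f 0 (Xt 0 ω)) (fun t => ξ s t ω) t) (z : Vec d) (t : ℕ) :
    ∫ ω, avg f (p (t + 1) ω).2 ∂Pr + α / (2 * γ) * ∫ ω, ‖(p (t + 1) ω).1 - z‖ ^ 2 ∂Pr
      ≤ (1 / 2 - α) * ∫ ω, avg f (p t ω).2 ∂Pr + α * avg f z + 1 / 2 * ∫ ω, avg f (Xt 0 ω) ∂Pr
        + α / (2 * γ) * ∫ ω, ‖(p t ω).1 - z‖ ^ 2 ∂Pr := by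
  have hle := hξ.past_le
  obtain ⟨h1, h2⟩ := Tame.loopAt hn hL hf hξ hX hXt α γ t
  obtain ⟨h1', h2'⟩ := Tame.loopAt hn hL hf hξ hX hXt α γ (t + 1)
  have h0 := hXt.mono (past_mono (ξ := ξ) (s := s) (s' := s) (t := 0) (t' := t) (by omega))
  have i1 := h1.integrable_norm_sub_sq (hle s t) z
  have i2 := h2.integrable_avg hn hL hf (hle s t) (ρ := 0) (by simp)
  have i1' := h1'.integrable_norm_sub_sq (hle s (t + 1)) z
  have i2' := h2'.integrable_avg hn hL hf (hle s (t + 1)) (ρ := 0) (by simp)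
  have i0 := h0.integrable_avg hn hL hf (hle s t) (ρ := 0) (by simp)
  have m1 := h1.measurable 0
  have m2 := h2.measurable 0
  have mt := h0.measurable 0
  simp only [Prod.fst_zero, Prod.snd_zero, ← hp] at i1 i2 i1' i2' m1 m2
  have key := (hξ.fresh s t).integral_le (Y := fun ω => ((p t ω).1, (p t ω).2, Xt 0 ω))
    (m1.prodMk (m2.prodMk mt)) (measurable_stepPotential hf α γ z)
    (Φ := fun q => (1 / 2 - α) * avg f q.2.1 + α * avg f z + 1 / 2 * avg f q.2.2
        + α / (2 * γ) * ‖q.1 - z‖ ^ 2)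
    (fun q => integral_stepPotential_le hn hL hf hα hα2 hγ hαγ q.1 q.2.1 q.2.2 z)
  have e : ∀ ω, stepPotential f α γ z (((p t ω).1, (p t ω).2, Xt 0 ω), ξ s (t + 1) ω)
      = avg f (p (t + 1) ω).2 + α / (2 * γ) * ‖(p (t + 1) ω).1 - z‖ ^ 2 := by
    intro ω
    rw [hp (t + 1), loopAt, ← hp t]
    rfl
  simp only [e] at key
  have key := key (i2'.add (i1'.const_mul _))
    ((((i2.const_mul _).add (integrable_const _)).add (i0.const_mul _)).add (i1.const_mul _))
  rw [integral_add i2' (i1'.const_mul _), integral_add (by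
      exact ((i2.const_mul _).add (integrable_const _)).add (i0.const_mul _)) (i1.const_mul _),
    integral_add (by exact (i2.const_mul _).add (integrable_const _)) (i0.const_mul _),
    integral_add (i2.const_mul _) (integrable_const _)] at key
  simpa only [integral_const_mul, integral_const, probReal_univ, one_smul] using key

/-- Summation of the inequalities of the inner iterations. -/
lemma sum_weighted_le {α κ F e₀ : ℝ} {e r : ℕ → ℝ} (hκ : 0 < κ) (h0 : e 0 = e₀)
    (h : ∀ t, e (t + 1) + 1 / (2 * κ) * r (t + 1)
      ≤ (1 / 2 - α) * e t + α * F + 1 / 2 * e₀ + 1 / (2 * κ) * r t) (t : ℕ) :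
    ∑ j ∈ Finset.Icc 1 t, κ * (α + 1 / 2) * (e j - F) + κ * (1 / 2 - α) * (e t - F) + 1 / 2 * r t
      ≤ κ * (1 / 2 - α + t / 2) * (e₀ - F) + 1 / 2 * r 0 := by
  induction t with
  | zero => simp [h0]
  | succ t ih =>
    rw [Finset.sum_Icc_succ_top (by omega)]
    -- At index `t + 1` the weights `κ (α + 1/2)` and `κ (1/2 - α)` add up to `κ`, so the new terms
    -- are exactly `κ` times the one-step inequality.
    have h1 := mul_le_mul_of_nonneg_left (h t) hκ.le
    have e1 : κ * (e (t + 1) + 1 / (2 * κ) * r (t + 1)) = κ * e (t + 1) + 1 / 2 * r (t + 1) := by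
      field_simp
    have e2 : κ * ((1 / 2 - α) * e t + α * F + 1 / 2 * e₀ + 1 / (2 * κ) * r t)
        = κ * ((1 / 2 - α) * e t + α * F + 1 / 2 * e₀) + 1 / 2 * r t := by
      field_simp
    rw [e1, e2] at h1
    push_cast
    linarith

lemma s0_pos : 1 ≤ s0 n d := by simp [s0]

lemma alpha_pos (s : ℕ) : 0 < alpha n d s := by
  unfold alpha
  split_ifs with h
  · norm_num
  · have : (s0 n d : ℝ) < s := by exact_mod_cast not_le.1 h
    have : (0 : ℝ) < (s : ℝ) - s0 n d + 4 := by linarith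
    positivity

lemma alpha_le (s : ℕ) : alpha n d s ≤ 1 / 2 := by
  unfold alpha
  split_ifs with h
  · norm_num
  · have h1 : (s0 n d : ℝ) < s := by exact_mod_cast not_le.1 h
    rw [div_le_div_iff₀ (by linarith) (by norm_num)]
    linarith

lemma gam_pos (hL : 0 < L) (s : ℕ) : 0 < gam n d L s := by
  have := alpha_pos (n := n) (d := d) s
  unfold gam
  positivity

lemma alpha_mul_gam (hL : 0 < L) (s : ℕ) :
    alpha n d s * gam n d L s = 1 / (12 * ((d : ℝ) + 4) * L) := by
  have := alpha_pos (n := n) (d := d) s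
  unfold gam
  field_simp

/-- The weight `γ_s / α_s`. -/
def ratio (n d : ℕ) (L : ℝ) (s : ℕ) : ℝ := gam n d L s / alpha n d s

lemma ratio_pos (hL : 0 < L) (s : ℕ) : 0 < ratio n d L s :=
  div_pos (gam_pos hL s) (alpha_pos s)

/-- The last weight `γ/α` is the common weight plus the leftover `(γ/α)(1/2 - α)`, which gives the
left side of `sum_weighted_le`. -/
lemma sum_theta_mul (s : ℕ) (a : ℕ → ℝ) :
    ∑ t ∈ Finset.Icc 1 (epochLength n d s), (convexParams n d L).θ s t * a t
      = ∑ t ∈ Finset.Icc 1 (epochLength n d s), ratio n d L s * (alpha n d s + 1 / 2) * a t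
        + ratio n d L s * (1 / 2 - alpha n d s) * a (epochLength n d s) := by
  obtain ⟨T, hT⟩ : ∃ T, epochLength n d s = T + 1 :=
    ⟨_, (Nat.succ_pred_eq_of_pos (epochLength_pos s)).symm⟩
  simp only [convexParams, ratio, hT]
  rw [Finset.sum_Icc_succ_top (by omega), Finset.sum_Icc_succ_top (by omega), if_neg (lt_irrefl _)]
  rw [Finset.sum_congr rfl fun t ht => by
    rw [if_pos (by have := Finset.mem_Icc.1 ht; omega)]]
  ring

/-- The total weight of an epoch. -/
def leftCoef (n d : ℕ) (L : ℝ) (s : ℕ) : ℝ :=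
  ratio n d L s * (1 / 2 - alpha n d s + epochLength n d s * (alpha n d s + 1 / 2))

/-- The factor of the pivotal value in the estimate of an epoch. -/
def rightCoef (n d : ℕ) (L : ℝ) (s : ℕ) : ℝ :=
  ratio n d L s * (1 / 2 - alpha n d s + epochLength n d s / 2)

lemma sum_theta (s : ℕ) :
    ∑ t ∈ Finset.Icc 1 (epochLength n d s), (convexParams n d L).θ s t = leftCoef n d L s := by
  have h := sum_theta_mul (n := n) (d := d) (L := L) s (fun _ => 1)
  simp only [mul_one] at h
  rw [h, leftCoef]
  simp
  ring

lemma leftCoef_pos (hL : 0 < L) (s : ℕ) : 0 < leftCoef n d L s := by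
  have h1 := alpha_pos (n := n) (d := d) s
  have h2 := alpha_le (n := n) (d := d) s
  have h3 : (1 : ℝ) ≤ epochLength n d s := by exact_mod_cast epochLength_pos s
  have h4 := ratio_pos (n := n) (d := d) hL s
  have h5 : 0 ≤ 1 / 2 - alpha n d s := by linarith
  unfold leftCoef
  positivity

lemma theta_nonneg (hL : 0 < L) (s t : ℕ) : 0 ≤ (convexParams n d L).θ s t := by
  have h1 := alpha_pos (n := n) (d := d) s
  have h2 := gam_pos (n := n) (d := d) hL s
  simp only [convexParams]
  split_ifs <;> positivity

lemma avg_epochAverage_le (hL : 0 < L) (hf : SmoothConvex f L) (s : ℕ) (xb : ℕ → Vec d) :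
    leftCoef n d L s * avg f (epochAverage (convexParams n d L) s xb)
      ≤ ∑ t ∈ Finset.Icc 1 (epochLength n d s), (convexParams n d L).θ s t * avg f (xb t) := by
  have h := hf.convexOn_avg.map_centerMass_le (t := Finset.Icc 1 (epochLength n d s))
    (w := (convexParams n d L).θ s) (p := xb) (fun t _ => theta_nonneg hL s t)
    (by rw [sum_theta]; exact leftCoef_pos hL s) (fun _ _ => Set.mem_univ _)
  have e : ∀ w : ℕ → ℝ, (Finset.Icc 1 (epochLength n d s)).centerMass ((convexParams n d L).θ s) w
      = (leftCoef n d L s)⁻¹ * ∑ t ∈ Finset.Icc 1 (epochLength n d s),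
        (convexParams n d L).θ s t * w t := by
    intro w
    rw [Finset.centerMass, sum_theta]
    rfl
  rw [e, le_inv_mul_iff₀ (leftCoef_pos hL s)] at h
  exact h

/-- The expected objective value at `x̃^s` for the limiting algorithm. -/
def meanValue (f : Fin n → Vec d → ℝ) (L : ℝ) (x0 : Vec d) (Pr : Measure Ω)
    (ξ : ℕ → ℕ → Ω → Fin n × Vec d) (s : ℕ) : ℝ :=
  ∫ ω, avg f (runAt f L 0 x0 (fun s t => ξ s t ω) s).2 ∂Pr

/-- The expected squared distance of `x^s` to `z` for the limiting algorithm. -/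
def meanDistSq (f : Fin n → Vec d → ℝ) (L : ℝ) (x0 : Vec d) (Pr : Measure Ω)
    (ξ : ℕ → ℕ → Ω → Fin n × Vec d) (z : Vec d) (s : ℕ) : ℝ :=
  ∫ ω, ‖(runAt f L 0 x0 (fun s t => ξ s t ω) s).1 - z‖ ^ 2 ∂Pr

/-- The one-step inequalities telescope with precisely the weights `θ_t`, and Jensen passes to the
averaged point `x̃^s`. The squared distance has coefficient `1/2` in every epoch, so it telescopes
across epochs too. -/
lemma expected_epoch_le [IsProbabilityMeasure Pr] (hn : 1 ≤ n) (hL : 0 < L)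
    (hf : SmoothConvex f L) (hξ : IsSampling Pr ξ) (x0 z : Vec d) (s : ℕ) :
    leftCoef n d L (s + 1) * (meanValue f L x0 Pr ξ (s + 1) - avg f z)
        + 1 / 2 * meanDistSq f L x0 Pr ξ z (s + 1)
      ≤ rightCoef n d L (s + 1) * (meanValue f L x0 Pr ξ s - avg f z)
        + 1 / 2 * meanDistSq f L x0 Pr ξ z s := by
  obtain ⟨hX, hXt⟩ := Tame.runAt hn hL hf hξ x0 s
  set α := alpha n d (s + 1) with hα
  set γ := gam n d L (s + 1) with hγ
  set T := epochLength n d (s + 1) with hT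
  set p : ℕ → Ω → Vec d × Vec d := fun t ω => loopAt f α γ 0
    (runAt f L 0 x0 (fun s t => ξ s t ω) s).1 (runAt f L 0 x0 (fun s t => ξ s t ω) s).2
      (pivotEst f 0 (runAt f L 0 x0 (fun s t => ξ s t ω) s).2)
        (fun t => ξ (s + 1) t ω) t with hp
  have hα0 : 0 < α := alpha_pos _
  have hγ0 : 0 < γ := gam_pos hL _
  have hstep := expected_step_le hn hL hf hξ hα0 (alpha_le _) hγ0 (alpha_mul_gam hL _) hX hXt
    (p := p) (fun t ω => rfl) z
  have hr : ∀ a : ℝ, α / (2 * γ) * a = 1 / (2 * ratio n d L (s + 1)) * a := by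
    intro a
    rw [ratio, ← hα, ← hγ]
    field_simp
  simp only [hr] at hstep
  have hsum := sum_weighted_le (e := fun t => ∫ ω, avg f (p t ω).2 ∂Pr)
    (r := fun t => ∫ ω, ‖(p t ω).1 - z‖ ^ 2 ∂Pr) (ratio_pos hL (s + 1)) rfl hstep T
  beta_reduce at hsum
  have hth := sum_theta_mul (n := n) (d := d) (L := L) (s + 1)
    (fun t => ∫ ω, avg f (p t ω).2 ∂Pr - avg f z)
  rw [← hT, ← hα] at hth
  rw [← hth] at hsum
  have hint : ∀ t, Integrable (fun ω => avg f (p t ω).2) Pr := fun t =>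
    (Tame.loopAt hn hL hf hξ hX hXt α γ t).2.integrable_avg hn hL hf (hξ.past_le _ _)
      (ρ := 0) (by simp)
  have hint' := (Tame.runAt hn hL hf hξ x0 (s + 1)).2.integrable_avg hn hL hf (hξ.past_le _ _)
      (ρ := 0) (by simp)
  have hjensen : leftCoef n d L (s + 1) * meanValue f L x0 Pr ξ (s + 1)
      ≤ ∑ t ∈ Finset.Icc 1 T, (convexParams n d L).θ (s + 1) t * ∫ ω, avg f (p t ω).2 ∂Pr := by
    rw [meanValue, ← integral_const_mul]
    simp only [← integral_const_mul]
    rw [← integral_finsetSum _ fun t _ => (hint t).const_mul _]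
    refine integral_mono (hint'.const_mul _)
      (integrable_finsetSum _ fun t _ => (hint t).const_mul _) fun ω => ?_
    exact avg_epochAverage_le hL hf (s + 1) (fun t => (p t ω).2)
  have h1 : ∑ t ∈ Finset.Icc 1 T, (convexParams n d L).θ (s + 1) t
        * (∫ ω, avg f (p t ω).2 ∂Pr - avg f z)
      = ∑ t ∈ Finset.Icc 1 T, (convexParams n d L).θ (s + 1) t * ∫ ω, avg f (p t ω).2 ∂Pr
        - leftCoef n d L (s + 1) * avg f z := by
    rw [← sum_theta, Finset.sum_mul, ← Finset.sum_sub_distrib]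
    simp only [mul_sub]
  rw [h1] at hsum
  rw [mul_sub]
  refine le_trans ?_ hsum
  have h2 : meanDistSq f L x0 Pr ξ z (s + 1) = ∫ ω, ‖(p T ω).1 - z‖ ^ 2 ∂Pr := rfl
  rw [h2]
  linarith

end Epochs

/-! ### The rate of the limiting algorithm -/

section Rate

variable {n d : ℕ} {f : Fin n → Vec d → ℝ} {L : ℝ}

/-- The constant value of `α_s γ_s`. -/
def stepConst (d : ℕ) (L : ℝ) : ℝ := 1 / (12 * ((d : ℝ) + 4) * L)

lemma stepConst_pos (hL : 0 < L) : 0 < stepConst d L := by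
  unfold stepConst; positivity

lemma ratio_eq (s : ℕ) : ratio n d L s = stepConst d L / alpha n d s ^ 2 := by
  have := alpha_pos (n := n) (d := d) s
  unfold ratio gam stepConst
  field_simp

lemma alpha_of_le {s : ℕ} (hs : s ≤ s0 n d) : alpha n d s = 1 / 2 := if_pos hs

lemma alpha_add {k : ℕ} (hk : 1 ≤ k) : alpha n d (s0 n d + k) = 2 / ((k : ℝ) + 4) := by
  rw [alpha, if_neg (by omega)]
  push_cast
  ring

lemma leftCoef_of_le {s : ℕ} (h1 : 1 ≤ s) (hs : s ≤ s0 n d) :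
    leftCoef n d L s = 2 * stepConst d L * 2 ^ s := by
  obtain ⟨r, rfl⟩ : ∃ r, s = r + 1 := ⟨s - 1, by omega⟩
  rw [leftCoef, ratio_eq, alpha_of_le hs, epochLength, if_pos hs, Nat.add_sub_cancel]
  push_cast
  ring

lemma leftCoef_add {k : ℕ} (hk : 1 ≤ k) : leftCoef n d L (s0 n d + k)
    = stepConst d L / 8 * ((k + 4) * k + 2 ^ (s0 n d - 1) * ((k + 4) * (k + 8))) := by
  rw [leftCoef, ratio_eq, alpha_add hk, epochLength, if_neg (by omega)]
  have : (0 : ℝ) < (k : ℝ) + 4 := by positivity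
  push_cast
  field_simp
  ring

lemma rightCoef_add {k : ℕ} (hk : 1 ≤ k) : rightCoef n d L (s0 n d + k)
    = stepConst d L / 8 * ((k + 4) * k + 2 ^ (s0 n d - 1) * (k + 4) ^ 2) := by
  rw [rightCoef, ratio_eq, alpha_add hk, epochLength, if_neg (by omega)]
  have : (0 : ℝ) < (k : ℝ) + 4 := by positivity
  push_cast
  field_simp
  ring

lemma rightCoef_one : rightCoef n d L 1 = 2 * stepConst d L := by
  rw [rightCoef, ratio_eq, alpha_of_le s0_pos, epochLength, if_pos s0_pos]
  norm_num
  ring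

/-- The schedule of `T_s` and `α_s` makes epochs chain. While `T_s` doubles there is equality;
afterwards, with `T = T_{s_0} ≥ 1`, the comparison reduces to `5 + 25T ≤ 32T` and then to `2k + 5 ≤
(2k + 7) T`. -/
lemma rightCoef_succ_le (hL : 0 < L) {s : ℕ} (hs : 1 ≤ s) :
    rightCoef n d L (s + 1) ≤ leftCoef n d L s := by
  have hc := stepConst_pos (d := d) hL
  have hT : (1 : ℝ) ≤ 2 ^ (s0 n d - 1) := one_le_pow₀ (by norm_num)
  rcases lt_trichotomy s (s0 n d) with h | h | h
  · rw [leftCoef_of_le hs h.le, rightCoef, ratio_eq, alpha_of_le h, epochLength,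
      if_pos (Nat.succ_le_of_lt h), Nat.add_sub_cancel]
    push_cast
    apply le_of_eq
    ring
  · have h0 : (2 : ℝ) ^ s = 2 * 2 ^ (s0 n d - 1) := by
      rw [← pow_succ', h, Nat.sub_add_cancel s0_pos]
    rw [leftCoef_of_le hs h.le, h0, h, rightCoef_add le_rfl]
    push_cast
    nlinarith
  · obtain ⟨k, hk, rfl⟩ : ∃ k, 1 ≤ k ∧ s = s0 n d + k := ⟨s - s0 n d, by omega, by omega⟩
    rw [leftCoef_add hk, add_assoc, rightCoef_add (by omega)]
    push_cast
    have hk0 : (0 : ℝ) ≤ k := k.cast_nonneg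
    gcongr stepConst d L / 8 * ?_
    nlinarith

lemma pow_s0_pred_le (hn : 1 ≤ n) : 2 ^ (s0 n d - 1) ≤ (d + 4) * n := by
  rw [s0, Nat.add_sub_cancel]
  exact Nat.pow_log_le_self 2 (Nat.mul_pos (by omega) hn).ne'

lemma le_pow_s0 : (d + 4) * n ≤ 2 ^ s0 n d :=
  (Nat.lt_pow_succ_log_self one_lt_two _).le

/-- The accelerated phase: `T_{s_0} ≥ (d+4)n/2`, and `α_s^{-2}` grows quadratically in `k`. -/
lemma le_leftCoef_add (hL : 0 < L) {k : ℕ} (hk : 1 ≤ k) :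
    stepConst d L / 16 * (((d : ℝ) + 4) * n * (k + 4) ^ 2) ≤ leftCoef n d L (s0 n d + k) := by
  have hc := stepConst_pos (d := d) hL
  have h1 : ((d : ℝ) + 4) * n ≤ 2 * 2 ^ (s0 n d - 1) := by
    rw [← pow_succ', Nat.sub_add_cancel s0_pos]
    exact_mod_cast le_pow_s0
  have hT : (0 : ℝ) < 2 ^ (s0 n d - 1) := by positivity
  have hk0 : (0 : ℝ) ≤ k := k.cast_nonneg
  rw [leftCoef_add hk]
  calc _ ≤ stepConst d L / 16 * (2 * 2 ^ (s0 n d - 1) * (k + 4) ^ 2) := by gcongr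
    _ = stepConst d L / 8 * (2 ^ (s0 n d - 1) * (k + 4) ^ 2) := by ring
    _ ≤ _ := by
      gcongr stepConst d L / 8 * ?_
      nlinarith [mul_nonneg hT.le hk0, mul_nonneg hk0 hk0]

/-- The accumulated difference of the coefficients of consecutive epochs. -/
def coefGap (n d : ℕ) (L : ℝ) (t : ℕ) : ℝ :=
  ∑ j ∈ Finset.range t, (leftCoef n d L (j + 1) - rightCoef n d L (j + 2))

variable {Ω : Type*} [m0 : MeasurableSpace Ω] {Pr : Measure Ω} {ξ : ℕ → ℕ → Ω → Fin n × Vec d}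

/-- As `z` need not minimize `f`, the mean gap may be negative, but it is at least `-η`. Lowering
its coefficient between epochs therefore costs at most `η` times the accumulated decrease. -/
lemma meanValue_recursion [IsProbabilityMeasure Pr] (hn : 1 ≤ n) (hL : 0 < L)
    (hf : SmoothConvex f L) (hξ : IsSampling Pr ξ) (x0 z : Vec d) {η : ℝ}
    (hz : ∀ y, avg f z ≤ avg f y + η) (t : ℕ) :
    leftCoef n d L (t + 1) * (meanValue f L x0 Pr ξ (t + 1) - avg f z)
        + 1 / 2 * meanDistSq f L x0 Pr ξ z (t + 1)
      ≤ 2 * stepConst d L * (avg f x0 - avg f z) + 1 / 2 * ‖x0 - z‖ ^ 2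
        + η * coefGap n d L t := by
  induction t with
  | zero =>
    have h := expected_epoch_le hn hL hf hξ x0 z 0
    have e1 : meanValue f L x0 Pr ξ 0 = avg f x0 := by simp [meanValue, runAt]
    have e2 : meanDistSq f L x0 Pr ξ z 0 = ‖x0 - z‖ ^ 2 := by simp [meanDistSq, runAt]
    rw [e1, e2, rightCoef_one] at h
    simpa [coefGap] using h
  | succ t ih =>
    have h := expected_epoch_le hn hL hf hξ x0 z (t + 1)
    have hlow : avg f z - η ≤ meanValue f L x0 Pr ξ (t + 1) := by
      have hint := (Tame.runAt hn hL hf hξ x0 (t + 1)).2.integrable_avg hn hL hf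
        (hξ.past_le _ _) (ρ := 0) (by simp)
      have h1 := integral_mono (integrable_const (avg f z - η)) hint
        (fun ω => sub_le_iff_le_add.2 (hz _))
      rwa [integral_const, probReal_univ, one_smul] at h1
    have hgap : 0 ≤ leftCoef n d L (t + 1) - rightCoef n d L (t + 2) :=
      sub_nonneg.2 (rightCoef_succ_le hL (by omega))
    have h2 := mul_le_mul_of_nonneg_left hlow hgap
    rw [coefGap, Finset.sum_range_succ, ← coefGap]
    rw [show t + 1 + 1 = t + 2 from rfl] at h ⊢
    linarith

/-- The quantity `D_0` for the limiting algorithm. -/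
def limitD0 (f : Fin n → Vec d → ℝ) (L : ℝ) (x0 z : Vec d) : ℝ :=
  2 / ((d : ℝ) + 4) * (avg f x0 - avg f z) + 6 * L * ‖x0 - z‖ ^ 2

lemma meanValue_le [IsProbabilityMeasure Pr] (hn : 1 ≤ n) (hL : 0 < L)
    (hf : SmoothConvex f L) (hξ : IsSampling Pr ξ) (x0 z : Vec d) {η : ℝ}
    (hz : ∀ y, avg f z ≤ avg f y + η) {s : ℕ} (hs : 1 ≤ s) :
    meanValue f L x0 Pr ξ s - avg f z
      ≤ (stepConst d L * (d + 4) * limitD0 f L x0 z + η * coefGap n d L (s - 1))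
        / leftCoef n d L s := by
  obtain ⟨t, rfl⟩ : ∃ t, s = t + 1 := ⟨s - 1, by omega⟩
  have h := meanValue_recursion hn hL hf hξ x0 z hz t
  have h1 : 0 ≤ meanDistSq f L x0 Pr ξ z (t + 1) := integral_nonneg fun ω => by positivity
  have h2 : stepConst d L * (d + 4) * limitD0 f L x0 z
      = 2 * stepConst d L * (avg f x0 - avg f z) + 1 / 2 * ‖x0 - z‖ ^ 2 := by
    unfold stepConst limitD0
    field_simp
    ring
  rw [le_div_iff₀ (leftCoef_pos hL _), h2, Nat.add_sub_cancel]
  linarith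

end Rate

/-! ### Gaussian smoothing -/

section Smoothing

variable {n d : ℕ} {f : Fin n → Vec d → ℝ} {L : ℝ}

/-- The smoothing error. -/
def smoothError (d : ℕ) (L μ : ℝ) : ℝ :=
  L / 2 * μ ^ 2 * ∫ u, ‖u‖ ^ 2 ∂(stdGaussian (Vec d))

lemma smoothError_nonneg (hL : 0 < L) (μ : ℝ) : 0 ≤ smoothError d L μ := by
  have : 0 ≤ ∫ u, ‖u‖ ^ 2 ∂(stdGaussian (Vec d)) := integral_nonneg fun u => by positivity
  unfold smoothError
  positivity

/-- Integrate the supporting hyperplane and the descent inequality at `x`; the linear term has mean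
zero. -/
lemma smoothed_bounds (hn : 1 ≤ n) (hf : SmoothConvex f L) (μ : ℝ) (x : Vec d) :
    avg f x ≤ smoothed μ (avg f) x ∧ smoothed μ (avg f) x ≤ avg f x + smoothError d L μ := by
  have hlin : Integrable (fun u : Vec d => avg f x + inner ℝ (μ • avgGrad f x) u)
      (stdGaussian (Vec d)) :=
    (integrable_const _).add (IsGaussian.integrable_fun_id.const_inner _)
  have hsq : Integrable (fun u : Vec d => L / 2 * μ ^ 2 * ‖u‖ ^ 2) (stdGaussian (Vec d)) :=
    (integrable_norm_pow_stdGaussian 2).const_mul _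
  have hlow : ∀ u, avg f x + inner ℝ (μ • avgGrad f x) u ≤ avg f (x + μ • u) := by
    intro u
    have := convex_gradient_le hf.hasGradientAt_avg hf.convexOn_avg x (x + μ • u)
    rwa [add_sub_cancel_left, real_inner_smul_right, ← real_inner_smul_left] at this
  have hup : ∀ u, avg f (x + μ • u)
      ≤ avg f x + inner ℝ (μ • avgGrad f x) u + L / 2 * μ ^ 2 * ‖u‖ ^ 2 := by
    intro u
    have := descent hf.hasGradientAt_avg (hf.avgGrad_lipschitz hn) x (μ • u)
    rw [real_inner_smul_right, ← real_inner_smul_left, norm_smul, mul_pow, Real.norm_eq_abs,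
      sq_abs] at this
    linarith
  have hm : Measurable (fun u : Vec d => avg f (x + μ • u)) := by
    have := (continuous_avg hf).measurable
    fun_prop
  have hint := integrable_of_le_of_le hm.aestronglyMeasurable (Filter.Eventually.of_forall hlow)
    (Filter.Eventually.of_forall hup) hlin (hlin.add hsq)
  have hval : ∫ u, (avg f x + inner ℝ (μ • avgGrad f x) u) ∂(stdGaussian (Vec d)) = avg f x := by
    rw [integral_add (integrable_const _) (IsGaussian.integrable_fun_id.const_inner _),
      integral_inner_stdGaussian]
    simp
  constructor
  · have h := integral_mono hlin hint hlow
    rwa [hval] at h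
  · have h := integral_mono hint (hlin.add hsq) hup
    rw [integral_add' hlin hsq, hval, integral_const_mul] at h
    exact h

variable {μ : ℝ} {x0 z : Vec d}

lemma avg_le_add_of_isMinOn (hn : 1 ≤ n) (hf : SmoothConvex f L)
    (hz : IsMinOn (smoothed μ (avg f)) Set.univ z) (y : Vec d) :
    avg f z ≤ avg f y + smoothError d L μ :=
  (smoothed_bounds hn hf μ z).1.trans
    ((isMinOn_iff.1 hz y (Set.mem_univ y)).trans (smoothed_bounds hn hf μ y).2)

/-- Near-minimality gives `‖∇f(z)‖² ≤ 2Lη`. Descent from `z` and Young's inequality do the rest. -/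
lemma avg_sub_le_of_near_min (hn : 1 ≤ n) (hL : 0 < L) (hf : SmoothConvex f L) {η : ℝ}
    (hz : ∀ y, avg f z ≤ avg f y + η) (x : Vec d) :
    avg f x - avg f z ≤ η + L * ‖x - z‖ ^ 2 := by
  have h1 := norm_gradient_sq_le hL hf.hasGradientAt_avg (hf.avgGrad_lipschitz hn) z hz
  have h2 := descent hf.hasGradientAt_avg (hf.avgGrad_lipschitz hn) z (x - z)
  rw [add_sub_cancel] at h2
  have h3 := real_inner_le_norm (avgGrad f z) (x - z)
  have h4 : L * (‖avgGrad f z‖ * ‖x - z‖) ≤ L * (η + L / 2 * ‖x - z‖ ^ 2) := by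
    nlinarith [sq_nonneg (‖avgGrad f z‖ - L * ‖x - z‖)]
  have h5 := le_of_mul_le_mul_left h4 hL
  linarith

lemma two_div_le_one : 2 / ((d : ℝ) + 4) ≤ 1 := by
  rw [div_le_one (by positivity)]
  have : (0 : ℝ) ≤ d := d.cast_nonneg
  linarith

lemma limitD0_le_D0 (hn : 1 ≤ n) (hL : 0 < L) (hf : SmoothConvex f L) :
    limitD0 f L x0 z ≤ D0 f L μ x0 z + smoothError d L μ := by
  have h1 := (smoothed_bounds hn hf μ x0).1
  have h2 := (smoothed_bounds hn hf μ z).2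
  have h3 : 2 / ((d : ℝ) + 4) * (avg f x0 - avg f z)
      ≤ 2 / ((d : ℝ) + 4) * (smoothed μ (avg f) x0 - smoothed μ (avg f) z)
        + 2 / ((d : ℝ) + 4) * smoothError d L μ := by
    rw [← mul_add]
    gcongr
    linarith
  have h4 := mul_le_mul_of_nonneg_right (two_div_le_one (d := d)) (smoothError_nonneg (d := d) hL μ)
  unfold limitD0 D0
  linarith

lemma six_mul_le_D0 (hz : IsMinOn (smoothed μ (avg f)) Set.univ z) :
    6 * L * ‖x0 - z‖ ^ 2 ≤ D0 f L μ x0 z := by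
  have h := isMinOn_iff.1 hz x0 (Set.mem_univ x0)
  have : 0 ≤ 2 / ((d : ℝ) + 4) * (smoothed μ (avg f) x0 - smoothed μ (avg f) z) :=
    mul_nonneg (by positivity) (sub_nonneg.2 h)
  unfold D0
  linarith

/-- Bounds `D_0(μ)` by the distance alone, so uniformly in `μ`; the `7` is the `6` of `D_0` plus `1`
from the function gap. -/
lemma D0_le (hn : 1 ≤ n) (hL : 0 < L) (hf : SmoothConvex f L)
    (hz : IsMinOn (smoothed μ (avg f)) Set.univ z) :
    D0 f L μ x0 z ≤ 2 * smoothError d L μ + 7 * L * ‖x0 - z‖ ^ 2 := by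
  have h1 := (smoothed_bounds hn hf μ x0).2
  have h2 := (smoothed_bounds hn hf μ z).1
  have h3 := avg_sub_le_of_near_min hn hL hf (avg_le_add_of_isMinOn hn hf hz) x0
  have h4 := isMinOn_iff.1 hz x0 (Set.mem_univ x0)
  have h5 := mul_le_mul_of_nonneg_right (two_div_le_one (d := d)) (sub_nonneg.2 h4)
  unfold D0
  linarith

end Smoothing

/-! ### The number of epochs -/

section Count

variable {n d : ℕ} {f : Fin n → Vec d → ℝ} {L : ℝ}

lemma epochLength_le (hn : 1 ≤ n) (s : ℕ) : epochLength n d s ≤ (d + 4) * n := by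
  refine le_trans ?_ (pow_s0_pred_le hn)
  unfold epochLength
  split_ifs with h
  · exact Nat.pow_le_pow_right (by norm_num) (by omega)
  · exact le_rfl

/-- Each epoch costs at most `2dn + 4(d+4)n`, and `d + 4 ≤ 5d`. -/
lemma numQueries_le (hn : 1 ≤ n) (hd : 1 ≤ d) (μ ν : ℝ) (x0 : Vec d)
    (ξ : ℕ → ℕ → Fin n × Vec d) (S : ℕ) :
    (numQueries f L μ ν x0 ξ S : ℝ) ≤ 22 * ((d : ℝ) * n) * S := by
  have h : numQueries f L μ ν x0 ξ S ≤ S * (22 * (d * n)) := by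
    rw [numQueries_eq]
    refine (Finset.sum_le_card_nsmul _ _ (22 * (d * n)) fun s _ => ?_).trans (by simp)
    have h1 := epochLength_le (d := d) hn (s + 1)
    have h2 : n ≤ d * n := Nat.le_mul_of_pos_left n hd
    nlinarith
  calc (numQueries f L μ ν x0 ξ S : ℝ) ≤ ((S * (22 * (d * n)) : ℕ) : ℝ) := by exact_mod_cast h
    _ = _ := by push_cast; ring

lemma add_four_le (hd : 1 ≤ d) : (d : ℝ) + 4 ≤ 5 * d := by
  have : (1 : ℝ) ≤ d := by exact_mod_cast hd
  linarith

lemma s0_le (hn : 1 ≤ n) (hd : 1 ≤ d) : (s0 n d : ℝ) ≤ 4 + 2 * Real.log ((d : ℝ) * n) := by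
  have hn' : (1 : ℝ) ≤ n := by exact_mod_cast hn
  have hd' : (1 : ℝ) ≤ d := by exact_mod_cast hd
  have h1 : (2 : ℝ) ^ (s0 n d - 1) ≤ ((d : ℝ) + 4) * n := by exact_mod_cast pow_s0_pred_le hn
  have h2 : (2 : ℝ) ^ s0 n d ≤ 2 ^ 4 * ((d : ℝ) * n) := by
    rw [← Nat.sub_add_cancel (s0_pos (n := n) (d := d)), pow_succ]
    nlinarith [add_four_le hd]
  have h3 := Real.log_le_log (by positivity) h2
  rw [Real.log_mul (by positivity) (by positivity), Real.log_pow, Real.log_pow] at h3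
  have h4 : 0 ≤ Real.log ((d : ℝ) * n) := Real.log_nonneg (by nlinarith)
  have h5 := Real.log_two_gt_d9
  push_cast at h3
  by_contra hcon
  push Not at hcon
  nlinarith

lemma complexity_nonneg (hn : 1 ≤ n) (hd : 1 ≤ d) (D ε : ℝ) : 0 ≤ complexity n d D ε := by
  have hn' : (1 : ℝ) ≤ n := by exact_mod_cast hn
  have hd' : (1 : ℝ) ≤ d := by exact_mod_cast hd
  have h4 : 0 ≤ Real.log ((d : ℝ) * n) := Real.log_nonneg (by nlinarith)
  unfold complexity
  split_ifs
  · have := Real.posLog_nonneg (x := d * D / ε)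
    positivity
  · positivity

/-- The number of epochs, if the number of components is large. -/
lemma exists_epochs_of_le (hL : 0 < L) (hd : 1 ≤ d) {D ε : ℝ}
    (hε : 0 < ε) (hDn : D / ε ≤ n) (hD2 : 2 < d * D / ε) :
    ∃ S : ℕ, 1 ≤ S ∧ S ≤ s0 n d ∧
      stepConst d L * (d + 4) * D / leftCoef n d L S ≤ ε / 2 ∧
      (S : ℝ) ≤ 10 * Real.posLog (d * D / ε) := by
  have hd' : (1 : ℝ) ≤ d := by exact_mod_cast hd
  have hc := stepConst_pos (d := d) hL
  have hy : (0 : ℝ) < d * D / ε := by linarith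
  have hD : 0 < D / ε := by
    rw [mul_div_assoc] at hy
    exact pos_of_mul_pos_right hy (by positivity)
  have hs0 : ((d : ℝ) + 4) * (D / ε) ≤ 2 ^ s0 n d := by
    calc ((d : ℝ) + 4) * (D / ε) ≤ ((d : ℝ) + 4) * n := by gcongr
      _ ≤ 2 ^ s0 n d := by exact_mod_cast le_pow_s0
  have hex : ∃ S : ℕ, ((d : ℝ) + 4) * (D / ε) ≤ 2 ^ S := ⟨_, hs0⟩
  classical
  -- In the doubling phase the error is `(d+4) D / 2^(S+1)`. The least sufficient `S` is taken, as
  -- minimality bounds it by a logarithm.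
  obtain ⟨S, hS, hmin⟩ : ∃ S : ℕ, ((d : ℝ) + 4) * (D / ε) ≤ 2 ^ S ∧
      ∀ T, T < S → ¬ ((d : ℝ) + 4) * (D / ε) ≤ 2 ^ T :=
    ⟨Nat.find hex, Nat.find_spec hex, fun T hT => Nat.find_min hex hT⟩
  have hSle : S ≤ s0 n d := by
    by_contra hcon
    exact hmin _ (not_le.1 hcon) hs0
  have hyeq : d * D / ε = d * (D / ε) := mul_div_assoc _ _ _
  have hS1 : 1 ≤ S := by
    by_contra hcon
    have h0 : S = 0 := by omega
    rw [h0, pow_zero] at hS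
    nlinarith
  refine ⟨S, hS1, hSle, ?_, ?_⟩
  · rw [leftCoef_of_le hS1 hSle, div_le_iff₀ (by positivity)]
    have h1 : ((d : ℝ) + 4) * D ≤ ε * 2 ^ S := by
      rw [← mul_div_assoc, div_le_iff₀ hε] at hS
      linarith
    nlinarith [mul_le_mul_of_nonneg_left h1 hc.le]
  · have h1 := not_le.1 (hmin (S - 1) (by omega))
    have h2 : (2 : ℝ) ^ S ≤ 2 ^ 4 * (d * D / ε) := by
      rw [← Nat.sub_add_cancel hS1, pow_succ, hyeq]
      nlinarith [add_four_le hd]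
    have h3 := Real.log_le_log (by positivity) h2
    rw [Real.log_mul (by positivity) hy.ne', Real.log_pow, Real.log_pow] at h3
    have h4 : Real.log 2 ≤ Real.log (d * D / ε) := Real.log_le_log (by norm_num) hD2.le
    have h5 := Real.log_two_gt_d9
    rw [Real.posLog_eq_log (by rw [abs_of_pos hy]; linarith)]
    push_cast at h3
    by_contra hcon
    push Not at hcon
    nlinarith

/-- The accuracy after `s0 + k` epochs. -/
lemma error_after_s0_le (hL : 0 < L) (hn : 1 ≤ n) {D ε : ℝ} (hε : 0 < ε)
    {k : ℕ} (hk1 : 1 ≤ k) (hk : √(32 * (D / (n * ε))) ≤ k) :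
    stepConst d L * (d + 4) * D / leftCoef n d L (s0 n d + k) ≤ ε / 2 := by
  have hn' : (0 : ℝ) < n := by exact_mod_cast hn
  have hc := stepConst_pos (d := d) hL
  have hk0 : (0 : ℝ) ≤ k := k.cast_nonneg
  -- By `le_leftCoef_add` the error is at most `16 D / (n (k+4)²)`; hence the `32` for accuracy
  -- `ε/2`.
  have h1 : 32 * (D / (n * ε)) ≤ (k + 4 : ℝ) ^ 2 := by
    rw [Real.sqrt_le_left hk0] at hk
    nlinarith
  rw [← mul_div_assoc, div_le_iff₀ (by positivity)] at h1
  rw [div_le_iff₀ (leftCoef_pos hL _)]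
  have h2 := le_leftCoef_add (n := n) (d := d) hL hk1
  calc stepConst d L * (d + 4) * D = stepConst d L * (d + 4) / 32 * (32 * D) := by ring
    _ ≤ stepConst d L * (d + 4) / 32 * ((k + 4) ^ 2 * (n * ε)) := by gcongr
    _ = ε / 2 * (stepConst d L / 16 * (((d : ℝ) + 4) * n * (k + 4) ^ 2)) := by ring
    _ ≤ _ := by gcongr

lemma epochs_after_s0_cost_le (hn : 1 ≤ n) (hd : 1 ≤ d) {D ε : ℝ} (hε : 0 < ε)
    (hDn : (n : ℝ) < D / ε) :
    22 * ((d : ℝ) * n) * ((s0 n d + ⌈√(32 * (D / (n * ε)))⌉₊ : ℕ) : ℝ)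
      ≤ 250 * complexity n d D ε := by
  have hn' : (1 : ℝ) ≤ n := by exact_mod_cast hn
  have hd' : (1 : ℝ) ≤ d := by exact_mod_cast hd
  have hq : 1 ≤ D / (n * ε) := by
    rw [one_le_div (by positivity)]
    rw [lt_div_iff₀ hε] at hDn
    exact hDn.le
  have hsq : 1 ≤ √(D / (n * ε)) := Real.one_le_sqrt.2 hq
  have hceil : (⌈√(32 * (D / (n * ε)))⌉₊ : ℝ) ≤ 7 * √(D / (n * ε)) := by
    have h1 := (Nat.ceil_lt_add_one (Real.sqrt_nonneg (32 * (D / (n * ε))))).le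
    have h2 : √(32 * (D / (n * ε))) ≤ 6 * √(D / (n * ε)) := by
      rw [Real.sqrt_mul (by norm_num)]
      gcongr
      rw [Real.sqrt_le_left (by norm_num)]
      norm_num
    linarith
  have hs := s0_le hn hd
  have hlog : 0 ≤ Real.log ((d : ℝ) * n) := Real.log_nonneg (by nlinarith)
  have hmul : (n : ℝ) * √(D / (n * ε)) = √(n * D / ε) := by
    rw [show (n : ℝ) * D / ε = n ^ 2 * (D / (n * ε)) by field_simp,
      Real.sqrt_mul (by positivity), Real.sqrt_sq (by positivity)]
  rw [complexity, if_neg (not_le.2 hDn), ← hmul]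
  push_cast
  have hdn : (0 : ℝ) < (d : ℝ) * n := by positivity
  calc 22 * ((d : ℝ) * n) * ((s0 n d : ℝ) + ⌈√(32 * (D / (n * ε)))⌉₊)
      ≤ 22 * ((d : ℝ) * n)
        * (4 * √(D / (n * ε)) + 2 * Real.log ((d : ℝ) * n) + 7 * √(D / (n * ε))) := by
        gcongr
        linarith
    _ ≤ 250 * ((d : ℝ) * n * Real.log ((d : ℝ) * n) + d * (n * √(D / (n * ε)))) := by
        nlinarith [mul_nonneg hdn.le hlog, mul_nonneg hdn.le (zero_le_one.trans hsq)]

end Count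

/-! ### Transfer to small smoothing parameters, and choice of the number of epochs -/

section Final

variable {n d : ℕ} {f : Fin n → Vec d → ℝ} {L : ℝ} {Ω : Type*} [m0 : MeasurableSpace Ω]
  {Pr : Measure Ω} {ξ : ℕ → ℕ → Ω → Fin n × Vec d}

lemma tendsto_smoothError :
    Filter.Tendsto (fun ρ : ℝ × ℝ => smoothError d L ρ.1) (nhds 0) (nhds 0) := by
  have h : Continuous (fun ρ : ℝ × ℝ => smoothError d L ρ.1) := by
    unfold smoothError
    fun_prop
  simpa [smoothError] using h.tendsto 0

/-- For small smoothing parameters, the bound of the limiting algorithm holds up to `ε`, uniformly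
for boundedly many epochs. -/
lemma eventually_close [IsProbabilityMeasure Pr] (hn : 1 ≤ n) (hL : 0 < L)
    (hf : SmoothConvex f L) (hξ : IsSampling Pr ξ) (x0 : Vec d) (N : ℕ) {ε : ℝ} (hε : 0 < ε) :
    ∀ᶠ ρ : ℝ × ℝ in nhds 0, ‖ρ‖ ≤ 1 ∧ smoothError d L ρ.1 ≤ 1 ∧ smoothError d L ρ.1 ≤ ε ∧
      ∀ S ∈ Set.Iic N,
        ∫ ω, avg f (runAt f L ρ x0 (fun s t => ξ s t ω) S).2 ∂Pr ≤ meanValue f L x0 Pr ξ S + ε ∧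
        smoothError d L ρ.1
          * ((stepConst d L * (d + 4) + coefGap n d L (S - 1)) / leftCoef n d L S) ≤ ε := by
  have h0 := tendsto_smoothError (d := d) (L := L)
  have hball : ∀ᶠ ρ : ℝ × ℝ in nhds 0, ‖ρ‖ ≤ 1 := by
    filter_upwards [Metric.closedBall_mem_nhds (0 : ℝ × ℝ) one_pos] with ρ hρ
    simpa using hρ
  refine hball.and ((h0.eventually_le_const one_pos).and ((h0.eventually_le_const hε).and ?_))
  rw [Filter.eventually_all_finite (Set.finite_Iic N)]
  intro S _
  refine Filter.Eventually.and ?_ ?_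
  · exact ((Tame.runAt hn hL hf hξ x0 S).2.tendsto_integral_avg hn hL hf
      (hξ.past_le _ _)).eventually_le_const (by rw [meanValue]; linarith)
  · have h1 := h0.mul_const ((stepConst d L * (d + 4) + coefGap n d L (S - 1)) / leftCoef n d L S)
    rw [zero_mul] at h1
    exact h1.eventually_le_const hε

/-- Only `s = 0` is used, where `x̃^0 = x^0` is deterministic. -/
lemma BoundedInExpectation.exists_dist_le [IsProbabilityMeasure Pr] {x0 : Vec d} {xs : ℝ → Vec d}
    (h : BoundedInExpectation Pr ξ f L x0 xs) :
    ∃ Z δ : ℝ, 0 < δ ∧ ∀ μ : ℝ, 0 < μ → μ < δ →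
      IsMinOn (smoothed μ (avg f)) Set.univ (xs μ) ∧ ‖x0 - xs μ‖ ≤ Z := by
  obtain ⟨Z, δ, hδ, h⟩ := h
  refine ⟨Z, δ, hδ, fun μ hμ hμδ => ?_⟩
  obtain ⟨h1, h2⟩ := h μ μ hμ hμδ hμ hμδ
  exact ⟨h1, by simpa [approx, run] using h2 0⟩

lemma meanValue_sub_optVal_le [IsProbabilityMeasure Pr] (hn : 1 ≤ n) (hL : 0 < L)
    (hf : SmoothConvex f L) (hξ : IsSampling Pr ξ) {x0 z : Vec d} {μ : ℝ}
    (hz : IsMinOn (smoothed μ (avg f)) Set.univ z) {S : ℕ} (hS : 1 ≤ S) :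
    meanValue f L x0 Pr ξ S - optVal f
      ≤ stepConst d L * (d + 4) * D0 f L μ x0 z / leftCoef n d L S
        + smoothError d L μ
          * ((stepConst d L * (d + 4) + coefGap n d L (S - 1)) / leftCoef n d L S)
        + smoothError d L μ := by
  have hmin := avg_le_add_of_isMinOn hn hf hz
  have h1 := meanValue_le hn hL hf hξ x0 z hmin hS
  have h2 : avg f z - smoothError d L μ ≤ optVal f :=
    le_ciInf fun y => sub_le_iff_le_add.2 (hmin y)
  have hl := leftCoef_pos (n := n) (d := d) hL S
  have hc := stepConst_pos (d := d) hL
  have h3 : stepConst d L * (d + 4) * limitD0 f L x0 z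
      ≤ stepConst d L * (d + 4) * (D0 f L μ x0 z + smoothError d L μ) := by
    gcongr
    exact limitD0_le_D0 hn hL hf
  have h4 : (stepConst d L * (d + 4) * limitD0 f L x0 z
        + smoothError d L μ * coefGap n d L (S - 1)) / leftCoef n d L S
      ≤ (stepConst d L * (d + 4) * (D0 f L μ x0 z + smoothError d L μ)
        + smoothError d L μ * coefGap n d L (S - 1)) / leftCoef n d L S := by gcongr
  have h5 : (stepConst d L * (d + 4) * (D0 f L μ x0 z + smoothError d L μ)
        + smoothError d L μ * coefGap n d L (S - 1)) / leftCoef n d L S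
      = stepConst d L * (d + 4) * D0 f L μ x0 z / leftCoef n d L S
        + smoothError d L μ
          * ((stepConst d L * (d + 4) + coefGap n d L (S - 1)) / leftCoef n d L S) := by ring
  linarith

/-- Enough epochs for accuracy `ε`, within the complexity bound. -/
lemma exists_epochs (hn : 1 ≤ n) (hd : 1 ≤ d) (hL : 0 < L) {D M ε : ℝ} (hε : 0 < ε) (hD : 0 ≤ D)
    (hDM : D ≤ M) :
    ∃ S : ℕ, S ≤ s0 n d + ⌈√(32 * (M / (n * ε)))⌉₊ ∧
      (S = 0 ∧ D ≤ 2 * ε ∨ 1 ≤ S ∧ stepConst d L * (d + 4) * D / leftCoef n d L S ≤ ε / 2) ∧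
      22 * ((d : ℝ) * n) * S ≤ 250 * complexity n d D ε := by
  have hd' : (1 : ℝ) ≤ d := by exact_mod_cast hd
  have hn' : (1 : ℝ) ≤ n := by exact_mod_cast hn
  rcases le_or_gt (D / ε) n with hDn | hDn
  -- Below the threshold `2` the initial point is accurate enough and no query is made. Above it the
  -- logarithm is at least `log 2`, which absorbs additive constants.
  · rcases le_or_gt (d * D / ε) 2 with h2 | h2
    · refine ⟨0, Nat.zero_le _, Or.inl ⟨rfl, ?_⟩, ?_⟩
      · rw [div_le_iff₀ hε] at h2
        nlinarith
      · simpa using mul_nonneg (by norm_num : (0 : ℝ) ≤ 250) (complexity_nonneg hn hd D ε)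
    · obtain ⟨S, h1, hs, he, hb⟩ := exists_epochs_of_le (L := L) hL hd hε hDn h2
      refine ⟨S, by omega, Or.inr ⟨h1, he⟩, ?_⟩
      rw [complexity, if_pos hDn]
      have := Real.posLog_nonneg (x := d * D / ε)
      have hdn : (0 : ℝ) < (d : ℝ) * n := by positivity
      nlinarith [mul_le_mul_of_nonneg_left hb hdn.le, mul_nonneg hdn.le this]
  · have hq : 0 < D / (n * ε) := by
      rw [lt_div_iff₀ hε] at hDn
      have : 0 < D := lt_of_le_of_lt (by positivity) hDn
      positivity
    have hk : 1 ≤ ⌈√(32 * (D / (n * ε)))⌉₊ := Nat.ceil_pos.2 (Real.sqrt_pos.2 (by positivity))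
    refine ⟨_, ?_, Or.inr ⟨?_, error_after_s0_le hL hn hε hk (Nat.le_ceil _)⟩,
      epochs_after_s0_cost_le hn hd hε hDn⟩
    · gcongr
    · omega

end Final

end

end ZOVarag

open ZOVarag in
theorem corollary1 :
    ∃ C : ℝ, 0 < C ∧
      ∀ (n d : ℕ), 1 ≤ n → 1 ≤ d →
      ∀ (f : Fin n → Vec d → ℝ) (L : ℝ), 0 < L → SmoothConvex f L →
      ∀ (x0 : Vec d) (Ω : Type*) [MeasurableSpace Ω] (Pr : Measure Ω) [IsProbabilityMeasure Pr]
        (ξ : ℕ → ℕ → Ω → Fin n × Vec d), IsSampling Pr ξ →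
      ∀ xs : ℝ → Vec d, BoundedInExpectation Pr ξ f L x0 xs →
      BddBelow (Set.range (avg f)) ∧
      ∀ ε : ℝ, 0 < ε →
      ∃ δ : ℝ, 0 < δ ∧ ∀ μ ν : ℝ, 0 < μ → μ < δ → 0 < ν → ν < δ →
        ∃ S : ℕ,
          (∀ ω, (numQueries f L μ ν x0 (fun s t => ξ s t ω) S : ℝ)
            ≤ C * complexity n d (D0 f L μ x0 (xs μ)) ε) ∧
          Integrable
            (fun ω => avg f (approx f L μ ν x0 (fun s t => ξ s t ω) S) - optVal f) Pr ∧
          ∫ ω, (avg f (approx f L μ ν x0 (fun s t => ξ s t ω) S) - optVal f) ∂Pr ≤ ε := by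
  refine ⟨250, by norm_num, ?_⟩
  intro n d hn hd f L hL hf x0 Ω _ Pr _ ξ hξ xs hxs
  obtain ⟨Z, δ₀, hδ₀, hZ⟩ := hxs.exists_dist_le
  refine ⟨?_, fun ε hε => ?_⟩
  · obtain ⟨h1, -⟩ := hZ (δ₀ / 2) (by linarith) (by linarith)
    refine ⟨avg f (xs (δ₀ / 2)) - smoothError d L (δ₀ / 2), ?_⟩
    rintro _ ⟨y, rfl⟩
    exact sub_le_iff_le_add.2 (avg_le_add_of_isMinOn hn hf h1 y)
  -- `2 + 7LZ²` bounds `D_0(μ)` once the smoothing error is at most `1`, so `N` bounds the number of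
  -- epochs independently of `μ` and `δ` can be chosen next.
  · set N := s0 n d + ⌈√(32 * ((2 + 7 * L * Z ^ 2) / (n * ε)))⌉₊ with hN
    obtain ⟨δ₁, hδ₁, hclose⟩ := Metric.eventually_nhds_iff.1
      (eventually_close hn hL hf hξ x0 N (ε := ε / 8) (by linarith))
    refine ⟨min δ₀ δ₁, lt_min hδ₀ hδ₁, fun μ ν hμ hμδ hν hνδ => ?_⟩
    obtain ⟨hmin, hdist⟩ := hZ μ hμ (hμδ.trans_le (min_le_left _ _))
    have hρ : dist (μ, ν) (0 : ℝ × ℝ) < δ₁ := by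
      rw [dist_zero_right, Prod.norm_mk, Real.norm_of_nonneg hμ.le, Real.norm_of_nonneg hν.le]
      exact max_lt (hμδ.trans_le (min_le_right _ _)) (hνδ.trans_le (min_le_right _ _))
    obtain ⟨hball, hone, herr, hS⟩ := hclose hρ
    simp only at hone herr hS
    have hD0 : 0 ≤ D0 f L μ x0 (xs μ) :=
      le_trans (by positivity) (six_mul_le_D0 (L := L) (x0 := x0) hmin)
    have hDM : D0 f L μ x0 (xs μ) ≤ 2 + 7 * L * Z ^ 2 := by
      have h1 := D0_le (x0 := x0) hn hL hf hmin
      have h2 : 7 * L * ‖x0 - xs μ‖ ^ 2 ≤ 7 * L * Z ^ 2 := by gcongr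
      linarith
    obtain ⟨S, hSN, hacc, hcost⟩ := exists_epochs (L := L) hn hd hL hε hD0 hDM
    have hint : Integrable (fun ω => avg f (approx f L μ ν x0 (fun s t => ξ s t ω) S)) Pr := by
      simp only [approx_eq_runAt hμ.ne' hν.ne']
      exact (Tame.runAt hn hL hf hξ x0 S).2.integrable_avg hn hL hf (hξ.past_le _ _) hball
    refine ⟨S, fun ω => (numQueries_le hn hd _ _ _ _ _).trans hcost,
      hint.sub (integrable_const _), ?_⟩
    rw [integral_sub hint (integrable_const _)]
    simp only [integral_const, probReal_univ, one_smul]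
    -- For `S = 0` the gap is at most `2 · ε/8 + D_0/6` with `D_0 ≤ 2ε`; otherwise it is at most
    -- `ε/2 + 3 · ε/8`.
    rcases hacc with ⟨rfl, hD⟩ | ⟨hS1, hacc⟩
    · have h1 := avg_le_add_of_isMinOn hn hf hmin
      have h2 := avg_sub_le_of_near_min hn hL hf h1 x0
      have h3 : avg f (xs μ) - smoothError d L μ ≤ optVal f :=
        le_ciInf fun y => sub_le_iff_le_add.2 (h1 y)
      have h4 := six_mul_le_D0 (L := L) (x0 := x0) hmin
      have h5 : ∫ ω, avg f (approx f L μ ν x0 (fun s t => ξ s t ω) 0) ∂Pr = avg f x0 := by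
        simp [approx, run]
      rw [h5]
      linarith
    · obtain ⟨h1, h2⟩ := hS S hSN
      have h3 := meanValue_sub_optVal_le (x0 := x0) hn hL hf hξ hmin hS1
      simp only [approx_eq_runAt hμ.ne' hν.ne']
      linarith
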